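/- Let $\kappa>0$ and $\Omega=\mathbb R^2\times(-\pi\kappa,\pi\kappa)$; write $\tilde x=(x_1,x_2)$ for $x\in\mathbb R^3$. For $\tilde x\neq 0$ let $$G(x)=\frac{2}{\kappa}\sum_{n=1}^\infty K_0\!\left(\frac{|\tilde x|\,n}{\kappa}\right)\cos\!\left(\frac{n x_3}{\kappa}\right)-\frac1\kappa\log|\tilde x|,\qquad \mathcal K(x)=\frac{1}{4\pi^2}\nabla G(x),$$ where $K_0(r)=\int_0^\infty e^{-r\cosh t}\,dt$, $r>0$, is the modified Bessel function of the second kind of order zero. Let $\Phi\in C^\infty(\mathbb R^3;\mathbb R^3)$ be $2\pi\kappa$-periodic in $x_3$ and compactly supported in $\tilde x$, i.e. for some $R$ it vanishes at all $x$ with $|\tilde x|>R$. Assume $\operatorname{div}\Phi=0$ and $\int_\Omega\Phi\,dx=0$. Then there is exactly one smooth vector field $u:\mathbb R^3\to\mathbb R^3$ with $$\operatorname{curl}u=\Phi,\qquad \operatorname{div}u=0,\qquad |u(x)|\to0\ \text{ as }|\tilde x|\to\infty\ \text{(uniformly in }x_3),\qquad u\ \ 2\pi\kappa\text{-periodic in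 }x_3,$$ and it is given by $$u(x)=\int_\Omega\mathcal K(x-y)\times\Phi(y)\,dy,$$ where the integral converges absolutely for every $x\in\mathbb R^3$. -/

import Mathlib

open MeasureTheory Filter Topology
open scoped ContDiff Gradient

noncomputable section

namespace PeriodicBiotSavart

/-- Euclidean three-space. The coordinates `x₁, x₂, x₃` are `x 0, x 1, x 2`. -/
abbrev E3 : Type := EuclideanSpace ℝ (Fin 3)

/-- The length `|x̃|` of the horizontal part `x̃ = (x₁, x₂)` of `x`. -/
def horizNorm (x : E3) : ℝ := Real.sqrt (x 0 ^ 2 + x 1 ^ 2)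

/-- One period `Ω = ℝ² × (-πκ, πκ)`. -/
def Omega (κ : ℝ) : Set E3 := {x | -(Real.pi * κ) < x 2 ∧ x 2 < Real.pi * κ}

/-- The partial derivative `∂ᵢ f`. -/
def partialD (i : Fin 3) (f : E3 → ℝ) (x : E3) : ℝ :=
  fderiv ℝ f x (EuclideanSpace.single i 1)

/-- The divergence of a vector field. -/
def divg (u : E3 → E3) (x : E3) : ℝ :=
  ∑ i, partialD i (fun y => u y i) x

/-- The curl of a vector field. -/
def curl (u : E3 → E3) (x : E3) : E3 :=
  !₂[partialD 1 (fun y => u y 2) x - partialD 2 (fun y => u y 1) x,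
     partialD 2 (fun y => u y 0) x - partialD 0 (fun y => u y 2) x,
     partialD 0 (fun y => u y 1) x - partialD 1 (fun y => u y 0) x]

/-- The cross product on Euclidean three-space. -/
def cross (a b : E3) : E3 :=
  WithLp.toLp 2 (crossProduct (WithLp.ofLp a) (WithLp.ofLp b))

/-- `f` has period `2πκ` in the `x₃`-direction. -/
def PeriodicX3 (κ : ℝ) (f : E3 → E3) : Prop :=
  ∀ x, f (x + EuclideanSpace.single 2 (2 * Real.pi * κ)) = f x

/-- The class `C^∞_{c,per}(Ω; ℝ³)`: smooth vector fields on `ℝ³` that are `2πκ`-periodic in `x₃`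
and supported in a cylinder `{|x̃| ≤ R}`. -/
structure IsSmoothCompactPeriodic (κ : ℝ) (f : E3 → E3) : Prop where
  smooth : ContDiff ℝ ∞ f
  periodic : PeriodicX3 κ f
  compact_support : ∃ R : ℝ, ∀ x, R < horizNorm x → f x = 0

/-- The modified Bessel function of the second kind of order zero at `r > 0`,
`K₀(r) = ∫₀^∞ exp (-r cosh t) dt`. -/
def besselK0 (r : ℝ) : ℝ :=
  ∫ t in Set.Ioi (0 : ℝ), Real.exp (-(r * Real.cosh t))

/-- The Green's function, `2πκ`-periodic in `x₃`, for `|x̃| ≠ 0`: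
`G(x) = (2/κ) ∑_{n ≥ 1} K₀(|x̃| n / κ) cos (n x₃ / κ) - (1/κ) log |x̃|`.
It is normalized so that `-ΔG` is `4π²` times the periodic Dirac mass. -/
def green (κ : ℝ) (x : E3) : ℝ :=
  2 / κ * ∑' n : ℕ, besselK0 (horizNorm x * ((n : ℝ) + 1) / κ) *
      Real.cos (((n : ℝ) + 1) * x 2 / κ)
    - 1 / κ * Real.log (horizNorm x)

/-- The Biot-Savart kernel `𝒦 = (1 / 4π²) ∇G`, for `|x̃| ≠ 0`. -/
def kernel (κ : ℝ) (x : E3) : E3 :=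
  (1 / (4 * Real.pi ^ 2)) • gradient (green κ) x

/-- `u` is a smooth solution of `curl u = Φ`, `div u = 0`, `|u(x)| → 0` as `|x̃| → ∞`,
`u` periodic in `x₃`. -/
structure IsSmoothSolution (κ : ℝ) (Φ u : E3 → E3) : Prop where
  smooth : ContDiff ℝ ∞ u
  curl_eq : ∀ x, curl u x = Φ x
  div_eq : ∀ x, divg u x = 0
  decay : Tendsto u (comap horizNorm atTop) (𝓝 0)
  periodic : PeriodicX3 κ u

end PeriodicBiotSavart

end

/-!
Biot–Savart law for fields on `ℝ³` that are periodic in `x₃`.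

The point is that the kernel `𝒦`, defined through a series of Bessel functions, is the sum over
all vertical translates of the Newtonian field of `ℝ³`:
`𝒦(x) = -(1 / 4π) ∑ₖ (x + 2πκk e₃) / |x + 2πκk e₃|³` for `x̃ ≠ 0` (`kernel_eq_tsum`). To see this,
write
`K₀(λ r) = ½ ∫₀^∞ t⁻¹ exp (-λ² t - r² / 4t) dt` (`besselK0_mul_eq`) and differentiate under the sum
and the integral (`hasFDerivAt_green`). For each fixed `t` the sum over the frequencies `λ` is a
theta series, which Jacobi's functional equation turns into a sum over images of Gaussians
(`one_add_tsum_cos`, `tsum_sin`); the derivative of the logarithm supplies the missing zero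
frequency. Integrating each Gaussian in `t` gives the Newtonian field of that image.

Unfolding, `∫_Ω 𝒦(x - y) × Φ(y) dy = -(1 / 4π) ∫_{ℝ³} N(y) × Φ(x - y) dy` with `N(y) = y / |y|³`
(`biotSavart_eq`). All integrals converge absolutely because `|y|⁻²` is integrable on vertical
cylinders (`integrableOn_inv_norm_sq_cyl`). Derivatives in `x` fall on `Φ`, which gives smoothness
(`contDiff_cylConv`), and dominated convergence gives decay (`tendsto_cylConv_newton`). The
equations follow from the two weak identities `curl N = 0` and `div N = 4π δ₀`
(`integral_newton_mul_partialD_symm`, `sum_integral_newton_mul_partialD`), which are proved for the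
regularization `y / (|y|² + ε²)^{3/2}` by parts and passed to the limit, together with
`curl (N × Φ) = N div Φ - (N · ∇) Φ`.

For uniqueness, the components of a difference of two solutions are harmonic, periodic in `x₃`, and
tend to zero away from the axis, so they vanish by the maximum principle (`nonpos_of_harmonic`).
-/

noncomputable section

namespace PeriodicBiotSavart

/-! ### Integrals of Gamma and Bessel type -/

lemma integrableOn_rpow_mul_exp_neg_div {a c : ℝ} (ha : 0 < a) (hc : 0 < c) :
    IntegrableOn (fun t : ℝ => t ^ (-a - 1) * Real.exp (-(c / t))) (Set.Ioi 0) := by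
  have h : IntegrableOn (fun t : ℝ => t ^ (a - 1) * Real.exp (-(c * t))) (Set.Ioi 0) := by
    have := integrableOn_rpow_mul_exp_neg_mul_rpow (p := 1) (s := a - 1) (by linarith) one_pos hc
    simpa using this
  rw [← integrableOn_Ioi_comp_rpow_iff' _ (p := -1) (by norm_num)] at h
  refine h.congr_fun (fun t (ht : 0 < t) => ?_) measurableSet_Ioi
  simp only [smul_eq_mul]
  rw [← Real.rpow_mul ht.le, ← mul_assoc, ← Real.rpow_add ht, Real.rpow_neg_one]
  congr 2
  ring

lemma integral_rpow_mul_exp_neg_div {a c : ℝ} (ha : 0 < a) (hc : 0 < c) :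
    ∫ t in Set.Ioi (0 : ℝ), t ^ (-a - 1) * Real.exp (-(c / t)) =
      (1 / c) ^ a * Real.Gamma a := by
  rw [← Real.integral_rpow_mul_exp_neg_mul_Ioi ha hc,
    ← integral_comp_rpow_Ioi (fun t : ℝ => t ^ (a - 1) * Real.exp (-(c * t))) (p := -1)
      (by norm_num)]
  refine setIntegral_congr_fun measurableSet_Ioi fun t (ht : 0 < t) => ?_
  simp only [smul_eq_mul, abs_neg, abs_one, one_mul]
  rw [← Real.rpow_mul ht.le, ← mul_assoc, ← Real.rpow_add ht, Real.rpow_neg_one]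
  congr 2
  ring

/-- The heat-kernel representation of `K₀`, obtained from the definition by the substitution
`t = (r / 2λ) eʷ`. -/
lemma besselK0_mul_eq {r l : ℝ} (hr : 0 < r) (hl : 0 < l) :
    besselK0 (r * l) =
      1 / 2 * ∫ t in Set.Ioi (0 : ℝ), t⁻¹ * Real.exp (-(l ^ 2 * t) - r ^ 2 / (4 * t)) := by
  have himg : (fun w : ℝ => r / (2 * l) * Real.exp w) '' Set.univ = Set.Ioi 0 := by
    ext t
    simp only [Set.image_univ, Set.mem_range, Set.mem_Ioi]
    constructor
    · rintro ⟨w, rfl⟩; positivity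
    · intro ht
      refine ⟨Real.log (t * (2 * l) / r), ?_⟩
      rw [Real.exp_log (by positivity)]
      field_simp
  have hcv := integral_image_eq_integral_abs_deriv_smul (s := Set.univ)
    (f := fun w : ℝ => r / (2 * l) * Real.exp w) (f' := fun w : ℝ => r / (2 * l) * Real.exp w)
    MeasurableSet.univ
    (fun w _ => ((Real.hasDerivAt_exp w).const_mul _).hasDerivWithinAt)
    (fun a _ b _ hab => by
      have : r / (2 * l) ≠ 0 := by positivity
      exact Real.exp_injective (mul_left_cancel₀ this hab))
    (fun t => t⁻¹ * Real.exp (-(l ^ 2 * t) - r ^ 2 / (4 * t)))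
  rw [himg] at hcv
  rw [hcv, setIntegral_univ, besselK0]
  have h2 := integral_comp_abs (f := fun t => Real.exp (-(r * l * Real.cosh t)))
  simp only [Real.cosh_abs] at h2
  have : (∫ t in Set.Ioi (0 : ℝ), Real.exp (-(r * l * Real.cosh t))) =
      1 / 2 * ∫ t, Real.exp (-(r * l * Real.cosh t)) := by rw [h2]; ring
  rw [this]
  congr 1
  refine integral_congr_ae (Eventually.of_forall fun w => ?_)
  simp only [smul_eq_mul]
  have hpos : 0 < r / (2 * l) * Real.exp w := by positivity
  rw [abs_of_pos hpos, ← mul_assoc, mul_inv_cancel₀ hpos.ne', one_mul, Real.cosh_eq]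
  congr 1
  rw [Real.exp_neg]
  have := Real.exp_pos w
  field_simp
  ring

lemma exp_neg_le_two_div_sq {s : ℝ} (hs : 0 < s) : Real.exp (-s) ≤ 2 / s ^ 2 := by
  have h := Real.quadratic_le_exp_of_nonneg hs.le
  rw [Real.exp_neg, inv_le_comm₀ (Real.exp_pos s) (by positivity), inv_div]
  nlinarith

lemma Gamma_three_halves : Real.Gamma (3 / 2) = √Real.pi / 2 := by
  rw [show (3 / 2 : ℝ) = 1 / 2 + 1 by norm_num, Real.Gamma_add_one (by norm_num),
    Real.Gamma_one_half_eq]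
  ring

/-- Integrating the three-dimensional heat kernel in time gives the Newtonian kernel. -/
lemma integral_heat_time {ρ : ℝ} (hρ : 0 < ρ) :
    ∫ t in Set.Ioi (0 : ℝ), t ^ (-(3 / 2) - 1 : ℝ) * Real.exp (-(ρ ^ 2 / 4 / t)) =
      4 * √Real.pi / ρ ^ 3 := by
  rw [integral_rpow_mul_exp_neg_div (by norm_num) (by positivity), Gamma_three_halves]
  have : (1 / (ρ ^ 2 / 4)) ^ (3 / 2 : ℝ) = 8 / ρ ^ 3 := by
    rw [show 1 / (ρ ^ 2 / 4) = (2 / ρ) ^ (2 : ℝ) by rw [Real.rpow_two]; field_simp; norm_num,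
      ← Real.rpow_mul (by positivity)]
    norm_num
    rw [div_pow]; norm_num
  rw [this]
  ring

/-! ### Differentiating the Bessel series -/

/-- The squared horizontal length `x₁² + x₂²`. -/
def horizSq (x : E3) : ℝ := x 0 ^ 2 + x 1 ^ 2

lemma horizSq_nonneg (x : E3) : 0 ≤ horizSq x := by unfold horizSq; positivity

lemma horizNorm_sq (x : E3) : horizNorm x ^ 2 = horizSq x :=
  Real.sq_sqrt (horizSq_nonneg x)

lemma continuous_horizSq : Continuous horizSq := by unfold horizSq; fun_prop

/-- The coordinate functional `x ↦ xᵢ`. -/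
abbrev coord (i : Fin 3) : E3 →L[ℝ] ℝ := EuclideanSpace.proj i

lemma norm_coord_le (i : Fin 3) : ‖coord i‖ ≤ 1 :=
  ContinuousLinearMap.opNorm_le_bound _ zero_le_one fun x => by
    simpa using PiLp.norm_apply_le x i

lemma hasFDerivAt_coord (i : Fin 3) (x : E3) : HasFDerivAt (fun y : E3 => y i) (coord i) x :=
  (coord i).hasFDerivAt

lemma hasFDerivAt_horizSq (x : E3) :
    HasFDerivAt horizSq ((2 * x 0) • coord 0 + (2 * x 1) • coord 1) x := by
  have h := ((hasFDerivAt_coord 0 x).pow 2).add ((hasFDerivAt_coord 1 x).pow 2)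
  refine h.congr_fderiv ?_
  ext v
  simp

/-- The frequency `(n + 1) / κ` of the `n`-th term of the Green's function. -/
def freq (κ : ℝ) (n : ℕ) : ℝ := ((n : ℝ) + 1) / κ

lemma freq_pos {κ : ℝ} (hκ : 0 < κ) (n : ℕ) : 0 < freq κ n := by unfold freq; positivity

lemma inv_freq_le {κ : ℝ} (hκ : 0 < κ) (n : ℕ) : (freq κ n)⁻¹ ≤ κ := by
  unfold freq
  rw [inv_div]
  exact div_le_self hκ.le (by linarith [(Nat.cast_nonneg n : (0 : ℝ) ≤ n)])

lemma summable_inv_freq_pow_three {κ : ℝ} (hκ : 0 < κ) :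
    Summable fun n : ℕ => (freq κ n)⁻¹ ^ 3 := by
  have h := (summable_nat_add_iff 1).2 (Real.summable_nat_pow_inv.2 (by norm_num : 1 < 3))
  refine (h.mul_left (κ ^ 3)).congr fun n => ?_
  unfold freq
  push_cast
  field_simp

/-- The amplitude `t⁻¹ exp (-λₙ² t - |x̃|² / 4t)`; integrated over `t` it gives `2 K₀(λₙ |x̃|)`. -/
def heatAmp (κ : ℝ) (p : ℕ × ℝ) (x : E3) : ℝ :=
  p.2⁻¹ * Real.exp (-(freq κ p.1 ^ 2 * p.2) - horizSq x / (4 * p.2))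

/-- The integrand over `ℕ × (0, ∞)` whose integral is the Bessel series. -/
def heatTerm (κ : ℝ) (p : ℕ × ℝ) (x : E3) : ℝ :=
  heatAmp κ p x * Real.cos (freq κ p.1 * x 2)

/-- The derivative of `heatTerm` in `x`. -/
def heatTermDeriv (κ : ℝ) (p : ℕ × ℝ) (x : E3) : E3 →L[ℝ] ℝ :=
  -(heatAmp κ p x * Real.cos (freq κ p.1 * x 2) / (2 * p.2)) • (x 0 • coord 0 + x 1 • coord 1)
    - (heatAmp κ p x * (freq κ p.1 * Real.sin (freq κ p.1 * x 2))) • coord 2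

lemma hasFDerivAt_heatTerm (κ : ℝ) (p : ℕ × ℝ) (x : E3) :
    HasFDerivAt (heatTerm κ p) (heatTermDeriv κ p x) x := by
  have h1 : HasFDerivAt (heatAmp κ p)
      (-(heatAmp κ p x / (2 * p.2)) • (x 0 • coord 0 + x 1 • coord 1)) x := by
    have := ((((hasFDerivAt_horizSq x).mul_const (4 * p.2)⁻¹).const_sub
      (-(freq κ p.1 ^ 2 * p.2))).exp).const_mul p.2⁻¹
    refine this.congr_fderiv ?_
    ext v
    simp [heatAmp]
    ring_nf
  have h2 : HasFDerivAt (fun y : E3 => Real.cos (freq κ p.1 * y 2))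
      (-(freq κ p.1 * Real.sin (freq κ p.1 * x 2)) • coord 2) x := by
    have := ((hasFDerivAt_coord 2 x).const_mul (freq κ p.1)).cos
    refine this.congr_fderiv ?_
    ext v
    simp
    ring
  refine (h1.mul h2).congr_fderiv ?_
  ext v
  simp [heatTermDeriv]
  ring

lemma heatAmp_nonneg {κ : ℝ} {p : ℕ × ℝ} (hp : 0 < p.2) (x : E3) : 0 ≤ heatAmp κ p x := by
  unfold heatAmp; positivity

/-- The frequency decay is traded for a power of `t⁻¹` by `exp (-s) ≤ 2 / s²`, so that the sum over
`n` converges; the factor `exp (-c / t)` absorbs that power as `t → 0`. -/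
lemma heatAmp_le {κ : ℝ} (hκ : 0 < κ) {p : ℕ × ℝ} (hp : 0 < p.2) {x : E3} {c : ℝ}
    (hx : 4 * c ≤ horizSq x) :
    heatAmp κ p x ≤ 2 * (freq κ p.1)⁻¹ ^ 4 * (p.2⁻¹ ^ 3 * Real.exp (-(c / p.2))) := by
  have hl := freq_pos hκ p.1
  unfold heatAmp
  have h1 : Real.exp (-(freq κ p.1 ^ 2 * p.2) - horizSq x / (4 * p.2)) ≤
      2 / (freq κ p.1 ^ 2 * p.2) ^ 2 * Real.exp (-(c / p.2)) := by
    rw [sub_eq_add_neg, Real.exp_add]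
    have h2 : -(horizSq x / (4 * p.2)) ≤ -(c / p.2) := by
      rw [neg_le_neg_iff, div_le_div_iff₀ hp (by positivity)]
      nlinarith
    exact mul_le_mul (exp_neg_le_two_div_sq (by positivity)) (Real.exp_le_exp.2 h2)
      (Real.exp_pos _).le (by positivity)
  calc _ ≤ p.2⁻¹ * (2 / (freq κ p.1 ^ 2 * p.2) ^ 2 * Real.exp (-(c / p.2))) := by gcongr
    _ = _ := by field_simp

/-- The measure on `ℕ × (0, ∞)` that turns a series of integrals into one integral. -/
abbrev modeTimeMeasure : Measure (ℕ × ℝ) :=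
  (Measure.count : Measure ℕ).prod (volume.restrict (Set.Ioi 0))

lemma ae_modeTimeMeasure_pos : ∀ᵐ p ∂modeTimeMeasure, 0 < p.2 :=
  Measure.quasiMeasurePreserving_snd.ae (ae_restrict_mem measurableSet_Ioi)

/-- The dominating function for `heatTerm` and `heatTermDeriv` on `{|x̃|² ≥ 4c}`. -/
def heatBound (κ c : ℝ) (p : ℕ × ℝ) : ℝ :=
  (freq κ p.1)⁻¹ ^ 3 * (p.2 ^ (-2 - 1 : ℝ) * Real.exp (-(c / p.2)) +
    p.2 ^ (-3 - 1 : ℝ) * Real.exp (-(c / p.2)))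

lemma heatBound_eq {κ c : ℝ} {p : ℕ × ℝ} (hp : 0 < p.2) : heatBound κ c p =
    (freq κ p.1)⁻¹ ^ 3 * ((p.2⁻¹ ^ 3 + p.2⁻¹ ^ 4) * Real.exp (-(c / p.2))) := by
  unfold heatBound
  rw [show (-2 - 1 : ℝ) = -((3 : ℕ) : ℝ) by norm_num,
    show (-3 - 1 : ℝ) = -((4 : ℕ) : ℝ) by norm_num, Real.rpow_neg hp.le, Real.rpow_neg hp.le,
    Real.rpow_natCast, Real.rpow_natCast]
  ring

lemma integrable_heatBound {κ c : ℝ} (hκ : 0 < κ) (hc : 0 < c) :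
    Integrable (heatBound κ c) modeTimeMeasure := by
  refine Integrable.mul_prod (f := fun n : ℕ => (freq κ n)⁻¹ ^ 3) ?_
    ((integrableOn_rpow_mul_exp_neg_div (a := 2) (by norm_num) hc).add
      (integrableOn_rpow_mul_exp_neg_div (a := 3) (by norm_num) hc))
  rw [integrable_count_iff]
  exact (summable_inv_freq_pow_three hκ).norm

lemma norm_heatTerm_le {κ : ℝ} (hκ : 0 < κ) {p : ℕ × ℝ} (hp : 0 < p.2) {x : E3} {c : ℝ}
    (hx : 4 * c ≤ horizSq x) : ‖heatTerm κ p x‖ ≤ 2 * κ * heatBound κ c p := by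
  have hl := freq_pos hκ p.1
  have hi := inv_freq_le hκ p.1
  have h := heatAmp_le hκ hp hx
  have hc : |Real.cos (freq κ p.1 * x 2)| ≤ 1 := Real.abs_cos_le_one _
  rw [heatTerm, norm_mul, Real.norm_of_nonneg (heatAmp_nonneg hp x), Real.norm_eq_abs,
    heatBound_eq hp]
  calc _ ≤ heatAmp κ p x * 1 := by gcongr; exact heatAmp_nonneg hp x
    _ ≤ 2 * (freq κ p.1)⁻¹ ^ 4 * (p.2⁻¹ ^ 3 * Real.exp (-(c / p.2))) := by simpa using h
    _ = 2 * (freq κ p.1)⁻¹ * ((freq κ p.1)⁻¹ ^ 3 * ((p.2⁻¹ ^ 3 + 0) * Real.exp (-(c / p.2)))) := by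
      ring
    _ ≤ _ := by gcongr; positivity

lemma norm_heatTermDeriv_le {κ : ℝ} (hκ : 0 < κ) {p : ℕ × ℝ} (hp : 0 < p.2) {x : E3} {c X : ℝ}
    (hx : 4 * c ≤ horizSq x) (hX : |x 0| + |x 1| ≤ X) :
    ‖heatTermDeriv κ p x‖ ≤ (X * κ + 2) * heatBound κ c p := by
  have hl := freq_pos hκ p.1
  have hi := inv_freq_le hκ p.1
  have hA := heatAmp_le hκ hp hx
  have hA0 := heatAmp_nonneg (κ := κ) hp x
  have hX0 : 0 ≤ X := by linarith [abs_nonneg (x 0), abs_nonneg (x 1)]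
  have hc : |Real.cos (freq κ p.1 * x 2)| ≤ 1 := Real.abs_cos_le_one _
  have hs : |Real.sin (freq κ p.1 * x 2)| ≤ 1 := Real.abs_sin_le_one _
  have h1 : ‖x 0 • coord 0 + x 1 • coord 1‖ ≤ X := by
    refine (norm_add_le _ _).trans (le_trans ?_ hX)
    rw [norm_smul, norm_smul, Real.norm_eq_abs, Real.norm_eq_abs]
    nlinarith [norm_coord_le 0, norm_coord_le 1, abs_nonneg (x 0), abs_nonneg (x 1)]
  have h2 : ‖heatTermDeriv κ p x‖ ≤
      heatAmp κ p x * (X / (2 * p.2)) + heatAmp κ p x * freq κ p.1 := by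
    refine (norm_sub_le _ _).trans (add_le_add ?_ ?_)
    · rw [norm_smul, norm_neg, norm_div, norm_mul, Real.norm_of_nonneg hA0, Real.norm_eq_abs,
        Real.norm_of_nonneg (by positivity : 0 ≤ 2 * p.2)]
      calc _ ≤ heatAmp κ p x * 1 / (2 * p.2) * X := by gcongr
        _ = _ := by ring
    · rw [norm_smul, norm_mul, norm_mul, Real.norm_of_nonneg hA0, Real.norm_of_nonneg hl.le,
        Real.norm_eq_abs]
      calc _ ≤ heatAmp κ p x * (freq κ p.1 * 1) * 1 := by gcongr; exact norm_coord_le 2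
        _ = _ := by ring
  refine h2.trans ?_
  rw [heatBound_eq hp, ← mul_add]
  set e := Real.exp (-(c / p.2))
  have he : 0 < e := Real.exp_pos _
  set l := (freq κ p.1)⁻¹ with hldef
  have hl0 : 0 < l := by positivity
  set s := p.2⁻¹ with hs'
  have hs0 : 0 < s := by positivity
  have e1 : X / (2 * p.2) = X / 2 * s := by rw [hs']; field_simp
  have e2 : freq κ p.1 = l⁻¹ := by rw [hldef, inv_inv]
  rw [e1, e2]
  calc _ ≤ 2 * l ^ 4 * (s ^ 3 * e) * (X / 2 * s + l⁻¹) := by gcongr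
    _ = X * l * (l ^ 3 * (s ^ 4 * e)) + 2 * (l ^ 3 * (s ^ 3 * e)) := by field_simp
    _ ≤ X * κ * (l ^ 3 * (s ^ 4 * e)) + 2 * (l ^ 3 * (s ^ 3 * e)) := by gcongr
    _ ≤ X * κ * (l ^ 3 * (s ^ 4 * e)) + 2 * (l ^ 3 * (s ^ 3 * e)) +
        (X * κ * (l ^ 3 * (s ^ 3 * e)) + 2 * (l ^ 3 * (s ^ 4 * e))) :=
      le_add_of_nonneg_right (by positivity)
    _ = _ := by ring

lemma measurable_heatAmp (κ : ℝ) (x : E3) : Measurable fun p => heatAmp κ p x := by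
  have : Measurable (freq κ) := Measurable.of_discrete
  unfold heatAmp
  fun_prop

lemma measurable_heatTerm (κ : ℝ) (x : E3) : Measurable fun p => heatTerm κ p x := by
  have : Measurable (freq κ) := Measurable.of_discrete
  have := measurable_heatAmp κ x
  unfold heatTerm
  fun_prop

lemma aestronglyMeasurable_heatTermDeriv (κ : ℝ) (x : E3) (μ : Measure (ℕ × ℝ)) :
    AEStronglyMeasurable (fun p => heatTermDeriv κ p x) μ := by
  have : Measurable (freq κ) := Measurable.of_discrete
  have := measurable_heatAmp κ x
  unfold heatTermDeriv
  refine AEStronglyMeasurable.sub ?_ ?_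
  · refine AEStronglyMeasurable.smul_const (Measurable.aestronglyMeasurable ?_) _
    fun_prop
  · refine AEStronglyMeasurable.smul_const (Measurable.aestronglyMeasurable ?_) _
    fun_prop

lemma integrable_heatTerm {κ : ℝ} (hκ : 0 < κ) {x : E3} (hx : 0 < horizSq x) :
    Integrable (fun p => heatTerm κ p x) modeTimeMeasure := by
  refine ((integrable_heatBound (c := horizSq x / 4) hκ (by positivity)).const_mul (2 * κ)).mono'
    (measurable_heatTerm κ x).aestronglyMeasurable ?_
  filter_upwards [ae_modeTimeMeasure_pos] with p hp
  exact norm_heatTerm_le hκ hp (by linarith)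

lemma integrable_heatTermDeriv {κ : ℝ} (hκ : 0 < κ) {x : E3} (hx : 0 < horizSq x) :
    Integrable (fun p => heatTermDeriv κ p x) modeTimeMeasure := by
  refine ((integrable_heatBound (c := horizSq x / 4) hκ (by positivity)).const_mul
    ((|x 0| + |x 1|) * κ + 2)).mono' (aestronglyMeasurable_heatTermDeriv κ x _) ?_
  filter_upwards [ae_modeTimeMeasure_pos] with p hp
  exact norm_heatTermDeriv_le hκ hp (by linarith) le_rfl

lemma hasFDerivAt_integral_heatTerm {κ : ℝ} (hκ : 0 < κ) {x : E3} (hx : 0 < horizSq x) :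
    HasFDerivAt (fun y => ∫ p, heatTerm κ p y ∂modeTimeMeasure)
      (∫ p, heatTermDeriv κ p x ∂modeTimeMeasure) x := by
  have hs : {y : E3 | horizSq x / 2 < horizSq y ∧ |y 0| + |y 1| < |x 0| + |x 1| + 1} ∈ 𝓝 x := by
    refine IsOpen.mem_nhds ?_ ⟨by linarith, by linarith⟩
    exact (isOpen_lt continuous_const continuous_horizSq).inter
      (isOpen_lt (f := fun y : E3 => |y 0| + |y 1|) (by fun_prop) continuous_const)
  refine hasFDerivAt_integral_of_dominated_of_fderiv_le
    (bound := fun p => ((|x 0| + |x 1| + 1) * κ + 2) * heatBound κ (horizSq x / 8) p) hs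
    (Eventually.of_forall fun y => (measurable_heatTerm κ y).aestronglyMeasurable)
    (integrable_heatTerm hκ hx) (aestronglyMeasurable_heatTermDeriv κ x _) ?_
    ((integrable_heatBound hκ (by positivity)).const_mul _)
    (Eventually.of_forall fun p y _ => hasFDerivAt_heatTerm κ p y)
  filter_upwards [ae_modeTimeMeasure_pos] with p hp y hy
  exact norm_heatTermDeriv_le hκ hp (by linarith [hy.1]) hy.2.le

lemma integral_modeTimeMeasure {F : ℕ × ℝ → ℝ} (hF : Integrable F modeTimeMeasure) :
    ∫ p, F p ∂modeTimeMeasure = ∑' n : ℕ, ∫ t in Set.Ioi (0 : ℝ), F (n, t) := by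
  rw [integral_prod _ hF, integral_countable hF.integral_prod_left]
  simp [Measure.real]

lemma integral_modeTimeMeasure_symm {F : ℕ × ℝ → ℝ} (hF : Integrable F modeTimeMeasure) :
    ∫ p, F p ∂modeTimeMeasure = ∫ t in Set.Ioi (0 : ℝ), ∑' n : ℕ, F (n, t) := by
  rw [integral_prod_symm _ hF]
  refine integral_congr_ae ?_
  filter_upwards [hF.prod_left_ae] with t ht
  rw [integral_countable ht]
  simp [Measure.real]

lemma green_eq {κ : ℝ} (hκ : 0 < κ) {x : E3} (hx : 0 < horizSq x) :
    green κ x = 1 / κ * ∫ p, heatTerm κ p x ∂modeTimeMeasure -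
      1 / (2 * κ) * Real.log (horizSq x) := by
  have hr : 0 < horizNorm x := Real.sqrt_pos.2 hx
  rw [green, integral_modeTimeMeasure (integrable_heatTerm hκ hx), ← horizNorm_sq,
    Real.log_pow, show 1 / κ = 2 / κ * (1 / 2) by ring, mul_assoc (2 / κ) (1 / 2) (tsum _),
    ← tsum_mul_left (a := (1 / 2 : ℝ))]
  congr 1
  · congr 1
    refine tsum_congr fun n => ?_
    rw [mul_div_assoc, ← freq, besselK0_mul_eq hr (freq_pos hκ n), horizNorm_sq,
      mul_div_right_comm, ← freq, mul_assoc, ← integral_mul_const]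
    rfl
  · push_cast
    field_simp

/-- The derivative of the Green's function away from the axis. -/
lemma hasFDerivAt_green {κ : ℝ} (hκ : 0 < κ) {x : E3} (hx : 0 < horizSq x) :
    HasFDerivAt (green κ) ((1 / κ) • (∫ p, heatTermDeriv κ p x ∂modeTimeMeasure) -
      (1 / κ * (horizSq x)⁻¹) • (x 0 • coord 0 + x 1 • coord 1)) x := by
  have h := ((hasFDerivAt_integral_heatTerm hκ hx).const_mul (1 / κ)).sub
    (((hasFDerivAt_horizSq x).log hx.ne').const_mul (1 / (2 * κ)))
  have hev : green κ =ᶠ[𝓝 x] fun y => 1 / κ * ∫ p, heatTerm κ p y ∂modeTimeMeasure -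
      1 / (2 * κ) * Real.log (horizSq y) := by
    filter_upwards [continuous_horizSq.continuousAt.eventually (lt_mem_nhds hx)] with y hy
    exact green_eq hκ hy
  refine (h.congr_of_eventuallyEq hev).congr_fderiv ?_
  congr 1
  ext v
  simp
  field_simp

/-! ### Jacobi's transformation: the kernel as a sum over images -/

/-- The theta function behind the Bessel series, transformed by Poisson summation. -/
lemma one_add_tsum_cos {κ t : ℝ} (hκ : 0 < κ) (ht : 0 < t) (z : ℝ) :
    1 + ∑' n : ℕ, 2 * (Real.exp (-(freq κ n ^ 2 * t)) * Real.cos (freq κ n * z)) =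
      √Real.pi * κ * t ^ (-(1 / 2) : ℝ) *
        ∑' k : ℤ, Real.exp (-((z + k * (2 * Real.pi * κ)) ^ 2 / (4 * t))) := by
  have hπ := Real.pi_pos
  set y : ℝ := Real.pi * κ ^ 2 / t with hy
  set a : ℝ := z / (2 * Real.pi * κ) with ha
  have hy0 : 0 < y := by positivity
  have h1 := (HurwitzZeta.hasSum_nat_cosKernel₀ a (t := 1 / y) (by positivity)).tsum_eq
  have h2 := (HurwitzZeta.hasSum_int_evenKernel a hy0).tsum_eq
  have h3 := HurwitzZeta.evenKernel_functional_equation a y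
  have e1 : ∑' n : ℕ, 2 * (Real.exp (-(freq κ n ^ 2 * t)) * Real.cos (freq κ n * z)) =
      HurwitzZeta.cosKernel a (1 / y) - 1 := by
    rw [← h1]
    refine tsum_congr fun n => ?_
    have e1 : 2 * Real.pi * a * (n + 1) = freq κ n * z := by
      rw [ha, freq]; field_simp
    have e2 : -Real.pi * ((n : ℝ) + 1) ^ 2 * (1 / y) = -(freq κ n ^ 2 * t) := by
      rw [hy, freq]; field_simp
    rw [e1, e2]
    ring
  have e2 : ∑' k : ℤ, Real.exp (-((z + k * (2 * Real.pi * κ)) ^ 2 / (4 * t))) =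
      HurwitzZeta.evenKernel a y := by
    rw [← h2]
    refine tsum_congr fun k => ?_
    congr 1
    rw [ha, hy]; field_simp; ring
  have e3 : √Real.pi * κ * t ^ (-(1 / 2) : ℝ) = y ^ (1 / 2 : ℝ) := by
    rw [hy, Real.div_rpow (by positivity) ht.le, Real.mul_rpow hπ.le (by positivity),
      ← Real.sqrt_eq_rpow, ← Real.sqrt_eq_rpow, Real.sqrt_sq hκ.le, Real.rpow_neg ht.le]
    rfl
  have : 0 < y ^ (1 / 2 : ℝ) := by positivity
  rw [e1, e2, e3, h3]
  field_simp
  ring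

/-- The `z`-derivative of `one_add_tsum_cos`. -/
lemma tsum_sin {κ t : ℝ} (hκ : 0 < κ) (ht : 0 < t) (z : ℝ) :
    ∑' n : ℕ, Real.exp (-(freq κ n ^ 2 * t)) * (freq κ n * Real.sin (freq κ n * z)) =
      √Real.pi * κ / 4 * t ^ (-(3 / 2) : ℝ) *
        ∑' k : ℤ, (z + k * (2 * Real.pi * κ)) *
          Real.exp (-((z + k * (2 * Real.pi * κ)) ^ 2 / (4 * t))) := by
  have hπ := Real.pi_pos
  set y : ℝ := Real.pi * κ ^ 2 / t with hy
  set a : ℝ := z / (2 * Real.pi * κ) with ha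
  have hy0 : 0 < y := by positivity
  have h1 := HurwitzZeta.hasSum_nat_sinKernel a (t := 1 / y) (by positivity)
  have h2 := (HurwitzZeta.hasSum_int_oddKernel a hy0).tsum_eq
  have h3 := HurwitzZeta.oddKernel_functional_equation a y
  have e1 : ∑' n : ℕ, Real.exp (-(freq κ n ^ 2 * t)) * (freq κ n * Real.sin (freq κ n * z)) =
      1 / (2 * κ) * HurwitzZeta.sinKernel a (1 / y) := by
    rw [← h1.tsum_eq, h1.summable.tsum_eq_zero_add]
    simp only [Nat.cast_zero, mul_zero, zero_mul, zero_add]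
    rw [← tsum_mul_left]
    refine tsum_congr fun n => ?_
    push_cast
    have e1 : 2 * Real.pi * a * (n + 1) = freq κ n * z := by
      rw [ha, freq]; field_simp
    have e2 : -Real.pi * ((n : ℝ) + 1) ^ 2 * (1 / y) = -(freq κ n ^ 2 * t) := by
      rw [hy, freq]; field_simp
    rw [e1, e2]
    generalize Real.exp _ = E
    generalize Real.sin _ = S
    rw [freq]
    field_simp
  have e2 : ∑' k : ℤ, (z + k * (2 * Real.pi * κ)) *
      Real.exp (-((z + k * (2 * Real.pi * κ)) ^ 2 / (4 * t))) =
      2 * Real.pi * κ * HurwitzZeta.oddKernel a y := by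
    rw [← h2, ← tsum_mul_left]
    refine tsum_congr fun k => ?_
    rw [← mul_assoc (2 * Real.pi * κ)]
    congr 1
    · rw [ha]; field_simp; ring
    · congr 1
      rw [ha, hy]; field_simp; ring
  have hs : √Real.pi ^ 2 = Real.pi := Real.sq_sqrt hπ.le
  have e3 : y ^ (3 / 2 : ℝ) = √Real.pi ^ 3 * κ ^ 3 * t ^ (-(3 / 2) : ℝ) := by
    have h1 : y = (√Real.pi * κ) ^ (2 : ℝ) / t := by
      rw [Real.rpow_two, mul_pow, hs]
    rw [h1, Real.div_rpow (by positivity) ht.le, ← Real.rpow_mul (by positivity),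
      Real.rpow_neg ht.le, show (2 * (3 / 2) : ℝ) = (3 : ℕ) by norm_num, Real.rpow_natCast, mul_pow]
    rfl
  have h4 : HurwitzZeta.sinKernel a (1 / y) = y ^ (3 / 2 : ℝ) * HurwitzZeta.oddKernel a y := by
    have : 0 < y ^ (3 / 2 : ℝ) := by positivity
    rw [h3]; field_simp
  rw [e1, e2, h4, e3]
  have e5 : √Real.pi ^ 3 = √Real.pi * Real.pi := by rw [pow_succ, hs, mul_comm]
  rw [e5]
  field_simp
  ring

/-- The Newtonian field `y / |y|³`. -/
def newton (y : E3) : E3 := (‖y‖ ^ 3)⁻¹ • y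

lemma norm_newton (y : E3) : ‖newton y‖ = (‖y‖ ^ 2)⁻¹ := by
  rcases eq_or_ne y 0 with rfl | hy
  · simp [newton]
  · have : 0 < ‖y‖ := norm_pos_iff.2 hy
    rw [newton, norm_smul, norm_inv, norm_pow, norm_norm]
    field_simp

/-- The vector `2πκ e₃`. -/
def period (κ : ℝ) : E3 := EuclideanSpace.single 2 (2 * Real.pi * κ)

@[simp] lemma period_zero (κ : ℝ) : period κ 0 = 0 := by simp [period]
@[simp] lemma period_one (κ : ℝ) : period κ 1 = 0 := by simp [period]
@[simp] lemma period_two (κ : ℝ) : period κ 2 = 2 * Real.pi * κ := by simp [period]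

lemma norm_sq_eq_horizSq (x : E3) : ‖x‖ ^ 2 = horizSq x + x 2 ^ 2 := by
  rw [EuclideanSpace.real_norm_sq_eq, Fin.sum_univ_three, horizSq]

@[simp] lemma horizSq_add_smul_period (κ a : ℝ) (x : E3) :
    horizSq (x + a • period κ) = horizSq x := by simp [horizSq]

lemma norm_pos_of_horizSq_pos {x : E3} (hx : 0 < horizSq x) : 0 < ‖x‖ := by
  have := norm_sq_eq_horizSq x
  by_contra! h
  have h0 : ‖x‖ = 0 := le_antisymm h (norm_nonneg _)
  rw [h0] at this
  nlinarith [sq_nonneg (x 2)]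

lemma summable_inv_norm_sq_image {κ : ℝ} (hκ : 0 < κ) (x : E3) :
    Summable fun k : ℤ => (‖x + (k : ℝ) • period κ‖ ^ 2)⁻¹ := by
  have hπ := Real.pi_pos
  have h := ((Real.summable_one_div_int_add_rpow (x 2 / (2 * Real.pi * κ)) 2).2
    (by norm_num)).mul_left ((2 * Real.pi * κ) ^ 2)⁻¹
  refine Summable.of_norm_bounded_eventually h ?_
  have hfin : {k : ℤ | ¬ ((k : ℝ) + x 2 / (2 * Real.pi * κ) ≠ 0)}.Finite := by
    refine Set.Subsingleton.finite fun a ha b hb => ?_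
    simp only [ne_eq, not_not, Set.mem_ofPred_eq] at ha hb
    exact_mod_cast (by linarith : (a : ℝ) = b)
  filter_upwards [hfin.eventually_cofinite_notMem] with k hk
  simp only [ne_eq, not_not] at hk
  rw [norm_inv, norm_pow, norm_norm, norm_sq_eq_horizSq, horizSq_add_smul_period, Real.rpow_two,
    sq_abs, one_div, ← mul_inv, ← mul_pow]
  have e : 2 * Real.pi * κ * (k + x 2 / (2 * Real.pi * κ)) = (x + (k : ℝ) • period κ) 2 := by
    simp; field_simp; ring
  rw [e]
  have h0 : (x + (k : ℝ) • period κ) 2 ≠ 0 := by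
    rw [← e]; exact mul_ne_zero (by positivity) hk
  have : 0 < (x + (k : ℝ) • period κ) 2 ^ 2 := by positivity
  gcongr
  linarith [horizSq_nonneg x]

lemma summable_norm_newton_image {κ : ℝ} (hκ : 0 < κ) (x : E3) :
    Summable fun k : ℤ => ‖newton (x + (k : ℝ) • period κ)‖ := by
  simpa only [norm_newton] using summable_inv_norm_sq_image hκ x

/-- Integrating in time a weighted sum of image heat kernels. -/
lemma integral_tsum_image {κ : ℝ} {x : E3} (hx : 0 < horizSq x) (w : ℤ → ℝ)
    (hw : Summable fun k : ℤ => |w k| * (‖x + (k : ℝ) • period κ‖ ^ 3)⁻¹) :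
    ∫ t in Set.Ioi (0 : ℝ), ∑' k : ℤ, w k * (t ^ (-(3 / 2) - 1 : ℝ) *
        Real.exp (-(‖x + (k : ℝ) • period κ‖ ^ 2 / 4 / t))) =
      4 * √Real.pi * ∑' k : ℤ, w k * (‖x + (k : ℝ) • period κ‖ ^ 3)⁻¹ := by
  have hρ (k : ℤ) : 0 < ‖x + (k : ℝ) • period κ‖ := norm_pos_of_horizSq_pos (by simpa using hx)
  have hs := hasSum_integral_of_summable_integral_norm (μ := volume.restrict (Set.Ioi (0 : ℝ)))
    (F := fun (k : ℤ) (t : ℝ) => w k * (t ^ (-(3 / 2) - 1 : ℝ) *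
        Real.exp (-(‖x + (k : ℝ) • period κ‖ ^ 2 / 4 / t))))
    (fun k => (integrableOn_rpow_mul_exp_neg_div (by norm_num)
      (by have := hρ k; positivity)).const_mul _) ?_
  · rw [← hs.tsum_eq, ← tsum_mul_left]
    refine tsum_congr fun k => ?_
    rw [integral_const_mul, integral_heat_time (hρ k)]
    ring
  · refine (hw.mul_left (4 * √Real.pi)).congr fun k => ?_
    have : ∀ t ∈ Set.Ioi (0 : ℝ), ‖w k * (t ^ (-(3 / 2) - 1 : ℝ) *
        Real.exp (-(‖x + (k : ℝ) • period κ‖ ^ 2 / 4 / t)))‖ = |w k| * (t ^ (-(3 / 2) - 1 : ℝ) *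
        Real.exp (-(‖x + (k : ℝ) • period κ‖ ^ 2 / 4 / t))) := by
      intro t (ht : 0 < t)
      rw [norm_mul, Real.norm_eq_abs, Real.norm_of_nonneg (by positivity)]
    rw [setIntegral_congr_fun measurableSet_Ioi this, integral_const_mul,
      integral_heat_time (hρ k)]
    ring

lemma integrable_tsum_modeTimeMeasure {F : ℕ × ℝ → ℝ} (hF : Integrable F modeTimeMeasure) :
    IntegrableOn (fun t => ∑' n : ℕ, F (n, t)) (Set.Ioi 0) := by
  refine hF.integral_prod_right.congr ?_
  filter_upwards [hF.prod_left_ae] with t ht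
  rw [integral_countable ht]
  simp [Measure.real]

lemma heatAmp_eq (κ : ℝ) (n : ℕ) (t : ℝ) (x : E3) : heatAmp κ (n, t) x =
    t⁻¹ * Real.exp (-(horizSq x / (4 * t))) * Real.exp (-(freq κ n ^ 2 * t)) := by
  rw [heatAmp, sub_eq_add_neg, Real.exp_add]
  ring

lemma exp_horiz_mul_exp_image (κ t : ℝ) (x : E3) (k : ℤ) :
    Real.exp (-(horizSq x / (4 * t))) *
      Real.exp (-((x 2 + k * (2 * Real.pi * κ)) ^ 2 / (4 * t))) =
    Real.exp (-(‖x + (k : ℝ) • period κ‖ ^ 2 / 4 / t)) := by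
  rw [← Real.exp_add, norm_sq_eq_horizSq, horizSq_add_smul_period]
  congr 1
  simp
  ring

/-- The radial part of the derivative of the Green's function. The term `|x̃|⁻²`, which comes from
the logarithm, is the time integral of the zero frequency of the theta series. -/
lemma integral_heatAmp_mul_cos {κ : ℝ} (hκ : 0 < κ) {x : E3} (hx : 0 < horizSq x) :
    (∫ p, heatAmp κ p x * Real.cos (freq κ p.1 * x 2) / (2 * p.2) ∂modeTimeMeasure) +
      (horizSq x)⁻¹ = Real.pi * κ * ∑' k : ℤ, (‖x + (k : ℝ) • period κ‖ ^ 3)⁻¹ := by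
  have hρ (k : ℤ) : 0 < ‖x + (k : ℝ) • period κ‖ := norm_pos_of_horizSq_pos (by simpa using hx)
  set F : ℕ × ℝ → ℝ := fun p => heatAmp κ p x * Real.cos (freq κ p.1 * x 2) / (2 * p.2) with hF
  have hFi : Integrable F modeTimeMeasure := by
    -- pairing the derivative with the horizontal direction isolates the radial coefficient
    have := ((integrable_heatTermDeriv hκ hx).apply_continuousLinearMap
      (!₂[x 0, x 1, 0] : E3)).const_mul (-(horizSq x)⁻¹)
    refine this.congr (Eventually.of_forall fun p => ?_)
    simp [heatTermDeriv, hF]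
    have hh : horizSq x = x 0 * x 0 + x 1 * x 1 := by rw [horizSq]; ring
    generalize heatAmp κ p x * Real.cos (freq κ p.1 * x 2) / (2 * p.2) = B
    field_simp
    rw [hh]
    ring
  have hq : (horizSq x)⁻¹ = ∫ t in Set.Ioi (0 : ℝ),
      1 / 4 * (t ^ (-1 - 1 : ℝ) * Real.exp (-(horizSq x / 4 / t))) := by
    rw [integral_const_mul, integral_rpow_mul_exp_neg_div one_pos (by positivity)]
    simp
    field_simp
  have hqi : IntegrableOn (fun t : ℝ =>
      1 / 4 * (t ^ (-1 - 1 : ℝ) * Real.exp (-(horizSq x / 4 / t)))) (Set.Ioi 0) :=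
    (integrableOn_rpow_mul_exp_neg_div one_pos (by positivity)).const_mul _
  have hw : Summable fun k : ℤ => |(1 : ℝ)| * (‖x + (k : ℝ) • period κ‖ ^ 3)⁻¹ := by
    refine Summable.of_nonneg_of_le (fun k => by positivity) (fun k => ?_)
      ((summable_inv_norm_sq_image hκ x).mul_left (√(horizSq x))⁻¹)
    have h1 : √(horizSq x) ≤ ‖x + (k : ℝ) • period κ‖ := by
      refine Real.sqrt_le_iff.2 ⟨norm_nonneg _, ?_⟩
      rw [norm_sq_eq_horizSq, horizSq_add_smul_period]
      nlinarith [sq_nonneg ((x + (k : ℝ) • period κ) 2)]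
    have h2 : 0 < √(horizSq x) := Real.sqrt_pos.2 hx
    have := hρ k
    rw [abs_one, one_mul, ← mul_inv]
    gcongr
    calc √(horizSq x) * ‖x + (k : ℝ) • period κ‖ ^ 2
        ≤ ‖x + (k : ℝ) • period κ‖ * ‖x + (k : ℝ) • period κ‖ ^ 2 := by gcongr
      _ = _ := by ring
  rw [integral_modeTimeMeasure_symm hFi, hq,
    ← integral_add (integrable_tsum_modeTimeMeasure hFi) hqi]
  have hs : √Real.pi ^ 2 = Real.pi := Real.sq_sqrt Real.pi_pos.le
  have key := integral_tsum_image hx (fun _ => 1) hw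
  simp only [one_mul] at key
  calc _ = ∫ t in Set.Ioi (0 : ℝ), √Real.pi * κ / 4 * ∑' k : ℤ, (t ^ (-(3 / 2) - 1 : ℝ) *
        Real.exp (-(‖x + (k : ℝ) • period κ‖ ^ 2 / 4 / t))) := by
        refine setIntegral_congr_fun measurableSet_Ioi fun t (ht : 0 < t) => ?_
        have hθ := one_add_tsum_cos hκ ht (x 2)
        have e1 : ∑' n : ℕ, F (n, t) = t⁻¹ ^ 2 / 4 * Real.exp (-(horizSq x / (4 * t))) *
            ∑' n : ℕ, 2 * (Real.exp (-(freq κ n ^ 2 * t)) * Real.cos (freq κ n * x 2)) := by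
          rw [← tsum_mul_left]
          refine tsum_congr fun n => ?_
          simp only [hF, heatAmp_eq]
          field_simp
          ring
        have e2 : t ^ (-1 - 1 : ℝ) = t⁻¹ ^ 2 := by
          rw [show (-1 - 1 : ℝ) = -((2 : ℕ) : ℝ) by norm_num, Real.rpow_neg ht.le,
            Real.rpow_natCast, inv_pow]
        have e3 : t⁻¹ ^ 2 * t ^ (-(1 / 2) : ℝ) = t ^ (-(3 / 2) - 1 : ℝ) := by
          rw [← e2, ← Real.rpow_add ht]; norm_num
        rw [e1, e2, show horizSq x / 4 / t = horizSq x / (4 * t) by rw [div_div]]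
        calc _ = t⁻¹ ^ 2 / 4 * Real.exp (-(horizSq x / (4 * t))) * (1 + ∑' n : ℕ,
              2 * (Real.exp (-(freq κ n ^ 2 * t)) * Real.cos (freq κ n * x 2))) := by ring
          _ = √Real.pi * κ / 4 * (t⁻¹ ^ 2 * t ^ (-(1 / 2) : ℝ) *
              (Real.exp (-(horizSq x / (4 * t))) *
              ∑' k : ℤ, Real.exp (-((x 2 + k * (2 * Real.pi * κ)) ^ 2 / (4 * t))))) := by
            rw [hθ]; ring
          _ = _ := by
            rw [← tsum_mul_left, e3, ← tsum_mul_left]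
            simp_rw [exp_horiz_mul_exp_image]
    _ = _ := by
        rw [integral_const_mul, key]
        calc _ = √Real.pi ^ 2 * κ * ∑' k : ℤ, (‖x + (k : ℝ) • period κ‖ ^ 3)⁻¹ := by ring
          _ = _ := by rw [hs]

/-- The vertical derivative of the Green's function. -/
lemma integral_heatAmp_mul_sin {κ : ℝ} (hκ : 0 < κ) {x : E3} (hx : 0 < horizSq x) :
    (∫ p, heatAmp κ p x * (freq κ p.1 * Real.sin (freq κ p.1 * x 2)) ∂modeTimeMeasure) =
      Real.pi * κ * ∑' k : ℤ, (x + (k : ℝ) • period κ) 2 * (‖x + (k : ℝ) • period κ‖ ^ 3)⁻¹ := by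
  have hρ (k : ℤ) : 0 < ‖x + (k : ℝ) • period κ‖ := norm_pos_of_horizSq_pos (by simpa using hx)
  set F : ℕ × ℝ → ℝ :=
    fun p => heatAmp κ p x * (freq κ p.1 * Real.sin (freq κ p.1 * x 2)) with hF
  have hFi : Integrable F modeTimeMeasure := by
    have := ((integrable_heatTermDeriv hκ hx).apply_continuousLinearMap
      (EuclideanSpace.single 2 1 : E3)).neg
    refine this.congr (Eventually.of_forall fun p => ?_)
    simp [heatTermDeriv, hF]
  have hw : Summable fun k : ℤ => |(x + (k : ℝ) • period κ) 2| *
      (‖x + (k : ℝ) • period κ‖ ^ 3)⁻¹ := by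
    refine Summable.of_nonneg_of_le (fun k => by positivity) (fun k => ?_)
      (summable_inv_norm_sq_image hκ x)
    have h1 : |(x + (k : ℝ) • period κ) 2| ≤ ‖x + (k : ℝ) • period κ‖ :=
      PiLp.norm_apply_le (x + (k : ℝ) • period κ) 2
    have := hρ k
    calc _ ≤ ‖x + (k : ℝ) • period κ‖ * (‖x + (k : ℝ) • period κ‖ ^ 3)⁻¹ := by gcongr
      _ = _ := by field_simp
  have hs : √Real.pi ^ 2 = Real.pi := Real.sq_sqrt Real.pi_pos.le
  have key := integral_tsum_image hx (fun k => (x + (k : ℝ) • period κ) 2) hw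
  rw [integral_modeTimeMeasure_symm hFi]
  calc _ = ∫ t in Set.Ioi (0 : ℝ), √Real.pi * κ / 4 * ∑' k : ℤ, (x + (k : ℝ) • period κ) 2 *
        (t ^ (-(3 / 2) - 1 : ℝ) * Real.exp (-(‖x + (k : ℝ) • period κ‖ ^ 2 / 4 / t))) := by
        refine setIntegral_congr_fun measurableSet_Ioi fun t (ht : 0 < t) => ?_
        have hθ := tsum_sin hκ ht (x 2)
        have e1 : ∑' n : ℕ, F (n, t) = t⁻¹ * Real.exp (-(horizSq x / (4 * t))) *
            ∑' n : ℕ, Real.exp (-(freq κ n ^ 2 * t)) * (freq κ n * Real.sin (freq κ n * x 2)) := by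
          rw [← tsum_mul_left]
          refine tsum_congr fun n => ?_
          simp only [hF, heatAmp_eq]
          ring
        have e3 : t⁻¹ * t ^ (-(3 / 2) : ℝ) = t ^ (-(3 / 2) - 1 : ℝ) := by
          rw [← Real.rpow_neg_one, ← Real.rpow_add ht]; norm_num
        rw [e1, hθ, ← e3]
        calc _ = √Real.pi * κ / 4 * (t⁻¹ * t ^ (-(3 / 2) : ℝ) *
              (Real.exp (-(horizSq x / (4 * t))) *
              ∑' k : ℤ, (x 2 + k * (2 * Real.pi * κ)) *
                Real.exp (-((x 2 + k * (2 * Real.pi * κ)) ^ 2 / (4 * t))))) := by ring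
          _ = _ := by
            rw [← tsum_mul_left, ← tsum_mul_left]
            congr 1
            refine tsum_congr fun k => ?_
            rw [← exp_horiz_mul_exp_image]
            simp
            ring
    _ = _ := by
        rw [integral_const_mul, key]
        calc _ = √Real.pi ^ 2 * κ * ∑' k : ℤ, (x + (k : ℝ) • period κ) 2 *
              (‖x + (k : ℝ) • period κ‖ ^ 3)⁻¹ := by ring
          _ = _ := by rw [hs]

/-- The Biot–Savart kernel is the sum of the Newtonian fields of all images. -/
lemma kernel_eq_tsum {κ : ℝ} (hκ : 0 < κ) {x : E3} (hx : 0 < horizSq x) :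
    kernel κ x = -(1 / (4 * Real.pi)) • ∑' k : ℤ, newton (x + (k : ℝ) • period κ) := by
  have hπ := Real.pi_pos
  have hsum : Summable fun k : ℤ => newton (x + (k : ℝ) • period κ) :=
    (summable_norm_newton_image hκ x).of_norm
  have hgrad (i : Fin 3) : (∇ (green κ) x) i =
      fderiv ℝ (green κ) x (EuclideanSpace.single i 1) := by
    have h : inner ℝ (∇ (green κ) x) (EuclideanSpace.single i 1) =
        fderiv ℝ (green κ) x (EuclideanSpace.single i 1) := by
      rw [gradient, InnerProductSpace.toDual_symm_apply]
    rw [← h, EuclideanSpace.inner_single_right]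
    simp
  have hcoord (i : Fin 3) : (∑' k : ℤ, newton (x + (k : ℝ) • period κ)) i =
      ∑' k : ℤ, (x + (k : ℝ) • period κ) i * (‖x + (k : ℝ) • period κ‖ ^ 3)⁻¹ := by
    have := (coord i).map_tsum hsum
    simp only [coord, PiLp.proj_apply] at this
    rw [this]
    refine tsum_congr fun k => ?_
    rw [newton, PiLp.smul_apply, smul_eq_mul, mul_comm]
  have hfd := (hasFDerivAt_green hκ hx).fderiv
  have hint := integrable_heatTermDeriv hκ hx
  have hr := integral_heatAmp_mul_cos hκ hx
  have hz := integral_heatAmp_mul_sin hκ hx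
  have hhor (i : Fin 3) (hi : ∀ p, heatTermDeriv κ p x (EuclideanSpace.single i 1) =
        -(heatAmp κ p x * Real.cos (freq κ p.1 * x 2) / (2 * p.2)) * x i)
      (hi' : (x 0 • coord 0 + x 1 • coord 1) (EuclideanSpace.single i 1 : E3) = x i)
      (hp : period κ i = 0) :
      kernel κ x i = (-(1 / (4 * Real.pi)) • ∑' k : ℤ, newton (x + (k : ℝ) • period κ)) i := by
    have h1 : (∫ p, heatTermDeriv κ p x ∂modeTimeMeasure) (EuclideanSpace.single i 1) =
        -(∫ p, heatAmp κ p x * Real.cos (freq κ p.1 * x 2) / (2 * p.2) ∂modeTimeMeasure) * x i := by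
      rw [ContinuousLinearMap.integral_apply hint]
      simp_rw [hi]
      rw [integral_mul_const, integral_neg]
    have h2 : fderiv ℝ (green κ) x (EuclideanSpace.single i 1) =
        -(Real.pi * ∑' k : ℤ, (‖x + (k : ℝ) • period κ‖ ^ 3)⁻¹) * x i := by
      rw [hfd, _root_.sub_apply, _root_.smul_apply,
        _root_.smul_apply, h1, hi', smul_eq_mul, smul_eq_mul]
      rw [eq_sub_of_add_eq hr]
      field_simp
      ring
    have h3 : ∑' k : ℤ, (x + (k : ℝ) • period κ) i * (‖x + (k : ℝ) • period κ‖ ^ 3)⁻¹ =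
        x i * ∑' k : ℤ, (‖x + (k : ℝ) • period κ‖ ^ 3)⁻¹ := by
      rw [← tsum_mul_left]
      refine tsum_congr fun k => ?_
      simp [hp]
    rw [kernel, PiLp.smul_apply, PiLp.smul_apply, hgrad, h2, hcoord, h3, smul_eq_mul, smul_eq_mul]
    field_simp
  ext i
  fin_cases i
  · exact hhor 0 (fun p => by simp [heatTermDeriv]) (by simp) (by simp)
  · exact hhor 1 (fun p => by simp [heatTermDeriv]) (by simp) (by simp)
  · change kernel κ x 2 = (-(1 / (4 * Real.pi)) • ∑' k : ℤ, newton (x + (k : ℝ) • period κ)) 2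
    have h1 : (∫ p, heatTermDeriv κ p x ∂modeTimeMeasure) (EuclideanSpace.single 2 1) =
        -∫ p, heatAmp κ p x * (freq κ p.1 * Real.sin (freq κ p.1 * x 2)) ∂modeTimeMeasure := by
      rw [ContinuousLinearMap.integral_apply hint, ← integral_neg]
      refine integral_congr_ae (Eventually.of_forall fun p => ?_)
      simp [heatTermDeriv]
    rw [kernel, PiLp.smul_apply, PiLp.smul_apply, hgrad, hcoord, hfd,
      _root_.sub_apply, _root_.smul_apply,
        _root_.smul_apply, h1, hz]
    simp
    field_simp
    exact tsum_congr fun k => by ring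

/-! ### Integrability of the Newtonian field on cylinders -/

/-- The vertical cylinder over the square `[-R, R]²`. -/
def cyl (R : ℝ) : Set E3 := {y | |y 0| ≤ R ∧ |y 1| ≤ R}

lemma isClosed_cyl (R : ℝ) : IsClosed (cyl R) :=
  (isClosed_le (f := fun y : E3 => |y 0|) (by fun_prop) continuous_const).inter
    (isClosed_le (f := fun y : E3 => |y 1|) (by fun_prop) continuous_const)

lemma measurableSet_cyl (R : ℝ) : MeasurableSet (cyl R) := (isClosed_cyl R).measurableSet

lemma mem_cyl_of_sub_mem {R S : ℝ} {x y : E3} (hx : ‖x‖ ≤ S) (h : x - y ∈ cyl R) :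
    y ∈ cyl (R + S) := by
  have hi (i : Fin 3) (h : |(x - y) i| ≤ R) : |y i| ≤ R + S := by
    have h1 : |x i| ≤ ‖x‖ := PiLp.norm_apply_le x i
    rw [PiLp.sub_apply] at h
    have := abs_sub_abs_le_abs_sub (y i) (x i)
    rw [abs_sub_comm] at this
    linarith
  exact ⟨hi 0 h.1, hi 1 h.2⟩

lemma integrable_cyl_indicator_mul_inv (R : ℝ) :
    IntegrableOn (fun y : E3 => (1 + y 2 ^ 2)⁻¹) (cyl R) := by
  rw [← integrable_indicator_iff (measurableSet_cyl R)]
  have hone : Integrable ((Set.Icc (-R) R).indicator fun _ : ℝ => (1 : ℝ)) :=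
    (integrable_indicator_iff measurableSet_Icc).2 (integrable_const _)
  let g : Fin 3 → ℝ → ℝ :=
    ![(Set.Icc (-R) R).indicator fun _ => 1, (Set.Icc (-R) R).indicator fun _ => 1,
      fun z => (1 + z ^ 2)⁻¹]
  have h : Integrable (fun y : Fin 3 → ℝ => ∏ i, g i (y i)) := by
    refine Integrable.fintype_prod fun i => ?_
    fin_cases i
    · exact hone
    · exact hone
    · exact integrable_inv_one_add_sq
  have h' := (EuclideanSpace.volume_preserving_symm_measurableEquiv_toLp (Fin 3)).integrable_comp
    h.aestronglyMeasurable |>.2 h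
  refine h'.congr (Eventually.of_forall fun y => ?_)
  simp only [Function.comp_apply, Fin.prod_univ_three, g]
  by_cases h0 : |y 0| ≤ R <;> by_cases h1 : |y 1| ≤ R <;>
    simp [Set.indicator, cyl, Set.mem_Icc, ← abs_le, h0, h1]

lemma integrableOn_inv_norm_sq_ball :
    IntegrableOn (fun y : E3 => (‖y‖ ^ 2)⁻¹) (Metric.ball 0 1) := by
  rw [integrableOn_fun_norm_addHaar volume (f := fun r : ℝ => (r ^ 2)⁻¹)]
  have : IntegrableOn (fun _ : ℝ => (1 : ℝ)) (Set.Ioo 0 1) := by simp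
  refine this.congr_fun (fun r hr => ?_) measurableSet_Ioo
  have : r ≠ 0 := hr.1.ne'
  simp
  field_simp

lemma integrableOn_inv_norm_sq_cyl (R : ℝ) :
    IntegrableOn (fun y : E3 => (‖y‖ ^ 2)⁻¹) (cyl R) := by
  have h2 : IntegrableOn (fun y : E3 => (‖y‖ ^ 2)⁻¹) (cyl R \ Metric.ball 0 1) := by
    refine (((integrable_cyl_indicator_mul_inv R).mono_set
      (s := cyl R \ Metric.ball 0 1) Set.sdiff_subset).const_mul 2).mono'
      (Measurable.aestronglyMeasurable (by fun_prop)) ?_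
    filter_upwards [ae_restrict_mem ((measurableSet_cyl R).diff measurableSet_ball)] with y hy
    have h1 : 1 ≤ ‖y‖ := by simpa using hy.2
    have h3 : y 2 ^ 2 ≤ ‖y‖ ^ 2 := by
      rw [norm_sq_eq_horizSq]; linarith [horizSq_nonneg y]
    rw [Real.norm_of_nonneg (by positivity), ← div_eq_mul_inv, inv_le_comm₀ (by positivity)
      (by positivity), inv_div]
    nlinarith
  refine (integrableOn_inv_norm_sq_ball.union h2).mono_set fun y hy => ?_
  by_cases h : y ∈ Metric.ball (0 : E3) 1
  · exact Or.inl h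
  · exact Or.inr ⟨hy, h⟩

lemma measurable_newton : Measurable newton := by
  unfold newton; fun_prop

lemma abs_newton_apply_le (y : E3) (i : Fin 3) : |newton y i| ≤ (‖y‖ ^ 2)⁻¹ := by
  rw [← norm_newton]; exact PiLp.norm_apply_le (newton y) i

/-! ### The cross product -/

lemma cross_zero_apply (a b : E3) : cross a b 0 = a 1 * b 2 - a 2 * b 1 := by
  simp [cross, cross_apply]

lemma cross_one_apply (a b : E3) : cross a b 1 = a 2 * b 0 - a 0 * b 2 := by
  simp [cross, cross_apply]

lemma cross_two_apply (a b : E3) : cross a b 2 = a 0 * b 1 - a 1 * b 0 := by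
  simp [cross, cross_apply]

lemma norm_cross_le (a b : E3) : ‖cross a b‖ ≤ ‖a‖ * ‖b‖ := by
  refine abs_le_of_sq_le_sq' ?_ (by positivity) |>.2
  rw [mul_pow, norm_sq_eq_horizSq, norm_sq_eq_horizSq, norm_sq_eq_horizSq, horizSq, horizSq,
    horizSq, cross_zero_apply, cross_one_apply, cross_two_apply]
  nlinarith [sq_nonneg (a 0 * b 0 + a 1 * b 1 + a 2 * b 2)]

/-- The cross product with a fixed right factor, as a continuous linear map. -/
def crossRight (b : E3) : E3 →L[ℝ] E3 :=
  LinearMap.toContinuousLinearMap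
    { toFun := fun a => cross a b
      map_add' := fun a a' => by simp [cross]
      map_smul' := fun r a => by simp [cross] }

@[simp] lemma crossRight_apply (a b : E3) : crossRight b a = cross a b := rfl

lemma continuous_cross : Continuous fun p : E3 × E3 => cross p.1 p.2 := by
  have : (fun p : E3 × E3 => cross p.1 p.2) = fun p => WithLp.toLp 2
      ![p.1 1 * p.2 2 - p.1 2 * p.2 1, p.1 2 * p.2 0 - p.1 0 * p.2 2,
        p.1 0 * p.2 1 - p.1 1 * p.2 0] := by
    funext p
    simp [cross, cross_apply]
  rw [this]
  refine (PiLp.continuous_toLp 2 _).comp (continuous_pi fun i => ?_)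
  fin_cases i <;> simp <;> fun_prop

/-! ### Unfolding integrals over one period -/

/-- The translate by `k` periods of the half-open slab `-πκ < x₃ ≤ πκ`. -/
def slab (κ : ℝ) (k : ℤ) : Set E3 :=
  {y | y 2 ∈ Set.Ioc (-(Real.pi * κ) + k • (2 * Real.pi * κ))
    (-(Real.pi * κ) + (k + 1) • (2 * Real.pi * κ))}

lemma measurable_apply_two : Measurable fun y : E3 => y 2 := by fun_prop

lemma measurableSet_slab (κ : ℝ) (k : ℤ) : MeasurableSet (slab κ k) :=
  measurable_apply_two measurableSet_Ioc

lemma iUnion_slab {κ : ℝ} (hκ : 0 < κ) : ⋃ k, slab κ k = Set.univ := by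
  have h := iUnion_Ioc_add_zsmul (p := 2 * Real.pi * κ) (by have := Real.pi_pos; positivity)
    (-(Real.pi * κ))
  have h2 : ⋃ k, slab κ k = (fun y : E3 => y 2) ⁻¹' Set.univ := by
    rw [← h, Set.preimage_iUnion]; rfl
  simpa using h2

lemma pairwise_disjoint_slab (κ : ℝ) : Pairwise (Function.onFun Disjoint (slab κ)) :=
  fun _ _ hij => Disjoint.preimage (fun y : E3 => y 2)
    (Set.pairwise_disjoint_Ioc_add_zsmul (-(Real.pi * κ)) (2 * Real.pi * κ) hij)

lemma preimage_slab (κ : ℝ) (k : ℤ) :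
    (fun y => y + (k : ℝ) • period κ) ⁻¹' slab κ k = slab κ 0 := by
  ext y
  simp only [slab, Set.mem_preimage, Set.mem_ofPred_eq, PiLp.add_apply, PiLp.smul_apply, period_two,
    Set.mem_Ioc, smul_eq_mul, zsmul_eq_mul, Int.cast_add, Int.cast_one, Int.cast_zero]
  constructor <;> rintro ⟨h1, h2⟩ <;> constructor <;> linarith

lemma volume_hyperplane (i : Fin 3) (c : ℝ) : volume {y : E3 | y i = c} = 0 := by
  have h := (EuclideanSpace.volume_preserving_symm_measurableEquiv_toLp (Fin 3)).measure_preimage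
    (s := {y : Fin 3 → ℝ | y i = c})
    (measurableSet_eq_fun (measurable_pi_apply i) measurable_const).nullMeasurableSet
  rw [show {y : E3 | y i = c} = (MeasurableEquiv.toLp 2 (Fin 3 → ℝ)).symm ⁻¹'
    {y : Fin 3 → ℝ | y i = c} from rfl, h]
  exact Measure.pi_hyperplane (fun _ : Fin 3 => (volume : Measure ℝ)) i c

lemma slab_zero_ae_eq (κ : ℝ) : slab κ 0 =ᵐ[volume] Omega κ := by
  have h : ∀ᵐ y : E3, y 2 ≠ Real.pi * κ := by
    rw [ae_iff]; simpa using volume_hyperplane 2 (Real.pi * κ)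
  filter_upwards [h] with y hy
  simp only [slab, Omega, eq_iff_iff]
  change (y 2 ∈ Set.Ioc _ _) ↔ (_ < y 2 ∧ y 2 < _)
  simp only [zero_smul, add_zero, zero_add, one_smul, Set.mem_Ioc]
  refine and_congr_right fun _ => ?_
  rw [show -(Real.pi * κ) + 2 * Real.pi * κ = Real.pi * κ by ring]
  exact ⟨fun h => lt_of_le_of_ne h hy, le_of_lt⟩

lemma restrict_Omega (κ : ℝ) : volume.restrict (Omega κ) = volume.restrict (slab κ 0) :=
  (Measure.restrict_congr_set (slab_zero_ae_eq κ)).symm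

lemma tsum_lintegral_translate {κ : ℝ} (hκ : 0 < κ) (g : E3 → ENNReal) :
    ∑' k : ℤ, ∫⁻ y in Omega κ, g (y + (k : ℝ) • period κ) = ∫⁻ y, g y := by
  rw [← setLIntegral_univ, ← iUnion_slab hκ,
    lintegral_iUnion (measurableSet_slab κ) (pairwise_disjoint_slab κ)]
  refine tsum_congr fun k => ?_
  rw [restrict_Omega, ← preimage_slab κ k]
  exact (measurePreserving_add_right volume ((k : ℝ) • period κ)).setLIntegral_comp_preimage_emb
    (MeasurableEquiv.addRight _).measurableEmbedding g _

/-- The integral over one period of the periodization is the integral over the whole space. -/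
lemma integral_tsum_translate {κ : ℝ} (hκ : 0 < κ) {f : E3 → E3} (hf : Integrable f) :
    ∫ y in Omega κ, ∑' k : ℤ, f (y + (k : ℝ) • period κ) = ∫ y, f y := by
  have hmp (k : ℤ) := measurePreserving_add_right (volume : Measure E3) ((k : ℝ) • period κ)
  rw [integral_tsum]
  · rw [← setIntegral_univ, ← iUnion_slab hκ,
      integral_iUnion (measurableSet_slab κ) (pairwise_disjoint_slab κ) hf.integrableOn]
    refine tsum_congr fun k => ?_
    rw [restrict_Omega, ← preimage_slab κ k]
    exact (hmp k).setIntegral_preimage_emb (MeasurableEquiv.addRight _).measurableEmbedding f _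
  · exact fun k => ((hmp k).integrable_comp_of_integrable hf).aestronglyMeasurable.restrict
  · rw [tsum_lintegral_translate hκ (fun y => ‖f y‖ₑ)]
    exact hf.hasFiniteIntegral.ne

lemma integrableOn_tsum_translate {κ : ℝ} (hκ : 0 < κ) {f g : E3 → E3} (hf : Integrable f)
    (hg : AEStronglyMeasurable g (volume.restrict (Omega κ)))
    (hfg : ∀ᵐ y, g y = ∑' k : ℤ, f (y + (k : ℝ) • period κ)) : IntegrableOn g (Omega κ) := by
  refine ⟨hg, ?_⟩
  have hmp (k : ℤ) := measurePreserving_add_right (volume : Measure E3) ((k : ℝ) • period κ)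
  calc ∫⁻ y in Omega κ, ‖g y‖ₑ
      ≤ ∫⁻ y in Omega κ, ∑' k : ℤ, ‖f (y + (k : ℝ) • period κ)‖ₑ := by
        refine lintegral_mono_ae (ae_restrict_of_ae ?_)
        filter_upwards [hfg] with y hy
        rw [hy]
        exact enorm_tsum_le_tsum_enorm
    _ = ∑' k : ℤ, ∫⁻ y in Omega κ, ‖f (y + (k : ℝ) • period κ)‖ₑ :=
        lintegral_tsum fun k =>
          ((hmp k).integrable_comp_of_integrable hf).aestronglyMeasurable.restrict.enorm
    _ = ∫⁻ y, ‖f y‖ₑ := tsum_lintegral_translate hκ (fun y => ‖f y‖ₑ)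
    _ < ⊤ := hf.hasFiniteIntegral

/-! ### Test fields and convolution with a singular weight -/

/-- Smooth functions that are `2πκ`-periodic in `x₃` and supported in a vertical cylinder, with
values in an arbitrary normed space, so that the class is closed under taking derivatives. -/
structure IsTestField (κ : ℝ) {F : Type*} [NormedAddCommGroup F] [NormedSpace ℝ F]
    (φ : E3 → F) : Prop where
  smooth : ContDiff ℝ ∞ φ
  periodic : Function.Periodic φ (period κ)
  support : ∃ R : ℝ, ∀ x, x ∉ cyl R → φ x = 0

lemma exists_add_zsmul_period {κ : ℝ} (hκ : 0 < κ) (x : E3) :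
    ∃ k : ℤ, (x + k • period κ) 2 ∈ Set.Icc 0 (2 * Real.pi * κ) := by
  obtain ⟨k, hk, -⟩ := existsUnique_add_zsmul_mem_Ico
    (by have := Real.pi_pos; positivity : 0 < 2 * Real.pi * κ) (x 2) 0
  refine ⟨k, ?_⟩
  have : (x + k • period κ) 2 = x 2 + k • (2 * Real.pi * κ) := by simp
  rw [this]
  exact ⟨hk.1, by simpa using hk.2.le⟩

lemma horizontal_add_zsmul_period (κ : ℝ) (x : E3) (k : ℤ) :
    (x + k • period κ) 0 = x 0 ∧ (x + k • period κ) 1 = x 1 := by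
  simp

lemma isCompact_cyl_inter (R a : ℝ) : IsCompact (cyl R ∩ {x | x 2 ∈ Set.Icc 0 a}) := by
  refine Metric.isCompact_of_isClosed_isBounded
    ((isClosed_cyl R).inter (isClosed_Icc.preimage (by fun_prop : Continuous fun y : E3 => y 2))) ?_
  refine isBounded_iff_forall_norm_le.2 ⟨√(2 * R ^ 2 + a ^ 2), fun x hx => ?_⟩
  refine Real.le_sqrt_of_sq_le ?_
  rw [norm_sq_eq_horizSq, horizSq]
  have h0 : x 0 ^ 2 ≤ R ^ 2 := sq_le_sq' (abs_le.1 hx.1.1).1 (abs_le.1 hx.1.1).2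
  have h1 : x 1 ^ 2 ≤ R ^ 2 := sq_le_sq' (abs_le.1 hx.1.2).1 (abs_le.1 hx.1.2).2
  have h2 : x 2 ^ 2 ≤ a ^ 2 := pow_le_pow_left₀ hx.2.1 hx.2.2 2
  linarith

section

variable {κ : ℝ} {F : Type*} [NormedAddCommGroup F] [NormedSpace ℝ F] {φ : E3 → F}

lemma IsTestField.bounded (hκ : 0 < κ) (h : IsTestField κ φ) : ∃ M, ∀ x, ‖φ x‖ ≤ M := by
  obtain ⟨R, hR⟩ := h.support
  obtain ⟨M, hM⟩ := (isCompact_cyl_inter R (2 * Real.pi * κ)).exists_bound_of_continuousOn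
    h.smooth.continuous.continuousOn
  refine ⟨max M 0, fun x => ?_⟩
  by_cases hx : x ∈ cyl R
  · obtain ⟨k, hk⟩ := exists_add_zsmul_period hκ x
    rw [← h.periodic.zsmul k x]
    obtain ⟨h0, h1⟩ := horizontal_add_zsmul_period κ x k
    exact (hM _ ⟨⟨by rw [h0]; exact hx.1, by rw [h1]; exact hx.2⟩, hk⟩).trans (le_max_left _ _)
  · rw [hR x hx, norm_zero]; exact le_max_right _ _

lemma IsTestField.fderiv (h : IsTestField κ φ) : IsTestField κ (fderiv ℝ φ) where
  smooth := h.smooth.fderiv_right (by simp)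
  periodic x := by
    rw [← fderiv_comp_add_right]
    congr 1
    funext y
    exact h.periodic y
  support := by
    obtain ⟨R, hR⟩ := h.support
    refine ⟨R, fun x hx => ?_⟩
    have : φ =ᶠ[𝓝 x] fun _ => 0 := by
      filter_upwards [(isClosed_cyl R).isOpen_compl.mem_nhds hx] with y hy using hR y hy
    rw [this.fderiv_eq]
    simp

lemma IsTestField.clm_comp {G : Type*} [NormedAddCommGroup G] [NormedSpace ℝ G] (L : F →L[ℝ] G)
    (h : IsTestField κ φ) : IsTestField κ fun x => L (φ x) where
  smooth := L.contDiff.comp h.smooth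
  periodic x := by simp [h.periodic x]
  support := by
    obtain ⟨R, hR⟩ := h.support
    exact ⟨R, fun x hx => by simp [hR x hx]⟩

lemma IsTestField.partialD {φ : E3 → ℝ} (h : IsTestField κ φ) (i : Fin 3) :
    IsTestField κ (partialD i φ) :=
  h.fderiv.clm_comp (ContinuousLinearMap.apply ℝ ℝ (EuclideanSpace.single i 1 : E3))

/-- A weight that is integrable on every vertical cylinder. -/
structure CylIntegrable (w : E3 → ℝ) : Prop where
  measurable : Measurable w
  integrableOn : ∀ R, IntegrableOn w (cyl R)

/-- The convolution `∫ w(y) φ(x - y) dy`. -/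
def cylConv (w : E3 → ℝ) (φ : E3 → F) (x : E3) : F := ∫ y, w y • φ (x - y)

variable {w : E3 → ℝ}

/-- A dominating function for `w(y) φ(x - y)`, uniform over `‖x‖ ≤ S`. -/
lemma norm_smul_comp_sub_le {R M S : ℝ} (hR : ∀ x, x ∉ cyl R → φ x = 0) (hM : ∀ x, ‖φ x‖ ≤ M)
    {x : E3} (hx : ‖x‖ ≤ S) (y : E3) :
    ‖w y • φ (x - y)‖ ≤ M * (cyl (R + S)).indicator (fun y => ‖w y‖) y := by
  have hM0 : 0 ≤ M := (norm_nonneg _).trans (hM 0)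
  by_cases h : x - y ∈ cyl R
  · rw [Set.indicator_of_mem (mem_cyl_of_sub_mem hx h), norm_smul, mul_comm]
    exact mul_le_mul_of_nonneg_right (hM _) (norm_nonneg _)
  · rw [hR _ h, smul_zero, norm_zero]
    exact mul_nonneg hM0 (Set.indicator_nonneg (fun _ _ => norm_nonneg _) _)

lemma CylIntegrable.integrable_indicator (hw : CylIntegrable w) (R : ℝ) :
    Integrable ((cyl R).indicator fun y => ‖w y‖) :=
  (integrable_indicator_iff (measurableSet_cyl R)).2 (hw.integrableOn R).norm

lemma aestronglyMeasurable_smul_comp_sub (hw : CylIntegrable w) (h : Continuous φ) (x : E3) :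
    AEStronglyMeasurable (fun y => w y • φ (x - y)) volume :=
  hw.measurable.aestronglyMeasurable.smul
    (h.comp (continuous_const.sub continuous_id)).aestronglyMeasurable

lemma CylIntegrable.integrable (hw : CylIntegrable w) (hκ : 0 < κ) (h : IsTestField κ φ) (x : E3) :
    Integrable fun y => w y • φ (x - y) := by
  obtain ⟨R, hR⟩ := h.support
  obtain ⟨M, hM⟩ := h.bounded hκ
  exact ((hw.integrable_indicator (R + ‖x‖)).const_mul M).mono'
    (aestronglyMeasurable_smul_comp_sub hw h.smooth.continuous x)
    (Eventually.of_forall fun y => norm_smul_comp_sub_le hR hM le_rfl y)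

lemma hasFDerivAt_cylConv (hκ : 0 < κ) (hw : CylIntegrable w) (h : IsTestField κ φ) (x : E3) :
    HasFDerivAt (cylConv w φ) (cylConv w (fderiv ℝ φ) x) x := by
  obtain ⟨R, hR⟩ := h.fderiv.support
  obtain ⟨M, hM⟩ := h.fderiv.bounded hκ
  refine hasFDerivAt_integral_of_dominated_of_fderiv_le (s := Metric.ball x 1)
    (F' := fun x y => w y • fderiv ℝ φ (x - y))
    (bound := fun y => M * (cyl (R + (‖x‖ + 1))).indicator (fun y => ‖w y‖) y)
    (Metric.ball_mem_nhds x one_pos)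
    (Eventually.of_forall fun z => aestronglyMeasurable_smul_comp_sub hw h.smooth.continuous z)
    (hw.integrable hκ h x)
    (aestronglyMeasurable_smul_comp_sub hw h.fderiv.smooth.continuous x) ?_
    ((hw.integrable_indicator _).const_mul M) ?_
  · refine Eventually.of_forall fun y z hz => norm_smul_comp_sub_le hR hM ?_ y
    have := norm_sub_norm_le z x
    rw [Metric.mem_ball, dist_eq_norm] at hz
    linarith
  · refine Eventually.of_forall fun y z _ => HasFDerivAt.const_smul ?_ (w y)
    have hd := (h.smooth.differentiable (by simp) (z - y)).hasFDerivAt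
    simpa [Function.comp_def] using hd.comp z ((hasFDerivAt_id z).sub_const y)

end

/-- Smoothness by induction: the derivative of `w ∗ φ` is `w ∗ φ'`, and `φ'` is again a test field,
with values in another space, so the claim is made for all target spaces at once. -/
lemma contDiff_cylConv {κ : ℝ} {w : E3 → ℝ} (hκ : 0 < κ) (hw : CylIntegrable w) (n : ℕ) :
    ∀ {F : Type} [NormedAddCommGroup F] [NormedSpace ℝ F] {φ : E3 → F},
      IsTestField κ φ → ContDiff ℝ n (cylConv w φ) := by
  induction n with
  | zero =>
    intro F _ _ φ h
    rw [Nat.cast_zero, contDiff_zero]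
    exact continuous_iff_continuousAt.2 fun x => (hasFDerivAt_cylConv hκ hw h x).continuousAt
  | succ n ih =>
    intro F _ _ φ h
    rw [Nat.cast_add, Nat.cast_one, contDiff_succ_iff_fderiv]
    refine ⟨fun x => (hasFDerivAt_cylConv hκ hw h x).differentiableAt, by simp, ?_⟩
    rw [show fderiv ℝ (cylConv w φ) = cylConv w (fderiv ℝ φ) from
      funext fun x => (hasFDerivAt_cylConv hκ hw h x).fderiv]
    exact ih h.fderiv

lemma contDiff_infty_cylConv {κ : ℝ} {w : E3 → ℝ} (hκ : 0 < κ) (hw : CylIntegrable w) {φ : E3 → ℝ}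
    (h : IsTestField κ φ) : ContDiff ℝ ∞ (cylConv w φ) :=
  contDiff_infty.2 fun n => contDiff_cylConv hκ hw n h

lemma partialD_cylConv {κ : ℝ} {w : E3 → ℝ} (hκ : 0 < κ) (hw : CylIntegrable w) {φ : E3 → ℝ}
    (h : IsTestField κ φ) (i : Fin 3) (x : E3) :
    partialD i (cylConv w φ) x = cylConv w (partialD i φ) x := by
  rw [partialD, (hasFDerivAt_cylConv hκ hw h x).fderiv, cylConv,
    ContinuousLinearMap.integral_apply (hw.integrable hκ h.fderiv x)]
  rfl

lemma cylIntegrable_newton (i : Fin 3) : CylIntegrable fun y => newton y i where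
  measurable := by have := measurable_newton; fun_prop
  integrableOn R := (integrableOn_inv_norm_sq_cyl R).mono'
    (Measurable.aestronglyMeasurable (by have := measurable_newton; fun_prop))
    (Eventually.of_forall fun y => abs_newton_apply_le y i)

/-! ### Decay away from the axis -/

lemma tendsto_cylConv_newton {κ : ℝ} (hκ : 0 < κ) {φ : E3 → ℝ} (h : IsTestField κ φ) (i : Fin 3) :
    Tendsto (cylConv (fun y => newton y i) φ) (comap horizNorm atTop) (𝓝 0) := by
  obtain ⟨R, hR⟩ := h.support
  obtain ⟨M, hM⟩ := h.bounded hκ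
  have hM0 : 0 ≤ M := (norm_nonneg _).trans (hM 0)
  -- translating by `x₃` leaves an integrand supported in a fixed cylinder
  let v : E3 → E3 → E3 := fun x y => y + (x 2) • EuclideanSpace.single 2 (1 : ℝ)
  have hrepr (x : E3) : cylConv (fun y => newton y i) φ x =
      ∫ y, newton (x - v x y) i • φ (v x y) := by
    rw [integral_add_right_eq_self (fun y => newton (x - y) i • φ y), cylConv,
      ← integral_sub_left_eq_self _ volume x]
    simp
  have hv2 (x y : E3) : (x - v x y) 2 = -y 2 := by simp [v]
  have hv0 (x y : E3) : (x - v x y) 0 = x 0 - y 0 := by simp [v]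
  have hv1 (x y : E3) : (x - v x y) 1 = x 1 - y 1 := by simp [v]
  have hcyl (x y : E3) (hy : y ∉ cyl R) : φ (v x y) = 0 := by
    refine hR _ fun hc => hy ?_
    simpa [cyl, v] using hc
  have hdist (x y : E3) (hy : y ∈ cyl R) (hx : 2 * |R| ≤ horizNorm x) :
      (horizNorm x - 2 * |R|) ^ 2 + y 2 ^ 2 ≤ ‖x - v x y‖ ^ 2 := by
    have h1 : horizNorm y ≤ 2 * |R| := by
      refine Real.sqrt_le_iff.2 ⟨by positivity, ?_⟩
      have h0 : y 0 ^ 2 ≤ R ^ 2 := sq_le_sq' (abs_le.1 hy.1).1 (abs_le.1 hy.1).2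
      have h1 : y 1 ^ 2 ≤ R ^ 2 := sq_le_sq' (abs_le.1 hy.2).1 (abs_le.1 hy.2).2
      rw [mul_pow, sq_abs]; nlinarith
    have hx0 : 0 ≤ horizNorm x := Real.sqrt_nonneg _
    have hy0 : 0 ≤ horizNorm y := Real.sqrt_nonneg _
    have hxs := horizNorm_sq x
    have hys := horizNorm_sq y
    have hcs : x 0 * y 0 + x 1 * y 1 ≤ horizNorm x * horizNorm y := by
      refine abs_le_of_sq_le_sq' ?_ (by positivity) |>.2
      rw [mul_pow, hxs, hys, horizSq, horizSq]
      nlinarith [sq_nonneg (x 0 * y 1 - x 1 * y 0)]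
    have h3 : (horizNorm x - horizNorm y) ^ 2 ≤ (x 0 - y 0) ^ 2 + (x 1 - y 1) ^ 2 := by
      rw [horizSq] at hxs hys
      nlinarith
    have h4 : (horizNorm x - 2 * |R|) ^ 2 ≤ (horizNorm x - horizNorm y) ^ 2 :=
      pow_le_pow_left₀ (by linarith) (by linarith) 2
    rw [norm_sq_eq_horizSq, horizSq, hv0, hv1, hv2]
    nlinarith
  have hmain (x y : E3) (d : ℝ) (hd : 0 < d) (hx : 2 * |R| + d ≤ horizNorm x) :
      ‖newton (x - v x y) i • φ (v x y)‖ ≤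
        M * (cyl R).indicator (fun y => (d ^ 2 + y 2 ^ 2)⁻¹) y := by
    by_cases hy : y ∈ cyl R
    · rw [Set.indicator_of_mem hy, norm_smul, mul_comm]
      refine mul_le_mul (hM _) ((abs_newton_apply_le _ i).trans ?_) (norm_nonneg _) hM0
      have := hdist x y hy (by linarith)
      gcongr
      refine le_trans ?_ this
      gcongr
      linarith
    · rw [Set.indicator_of_notMem hy, hcyl x y hy]; simp
  simp_rw [funext hrepr]
  rw [show (0 : ℝ) = ∫ _ : E3, (0 : ℝ) by simp]
  refine tendsto_integral_filter_of_dominated_convergence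
    (fun y => M * (cyl R).indicator (fun y => (1 ^ 2 + y 2 ^ 2)⁻¹) y) ?_ ?_ ?_ ?_
  · refine Eventually.of_forall fun x => Measurable.aestronglyMeasurable ?_
    have := measurable_newton
    have := h.smooth.continuous.measurable
    simp only [v]
    fun_prop
  · filter_upwards [tendsto_comap.eventually (eventually_ge_atTop (2 * |R| + 1))] with x hx
    exact Eventually.of_forall fun y => hmain x y 1 one_pos hx
  · have := (integrable_indicator_iff (measurableSet_cyl R)).2 (integrable_cyl_indicator_mul_inv R)
    simpa using this.const_mul M
  · refine Eventually.of_forall fun y => ?_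
    have hlim : Tendsto (fun x : E3 => M * ((horizNorm x - 2 * |R|) ^ 2)⁻¹)
        (comap horizNorm atTop) (𝓝 0) := by
      have : Tendsto (fun s : ℝ => M * ((s - 2 * |R|) ^ 2)⁻¹) atTop (𝓝 (M * 0)) :=
        ((tendsto_inv_atTop_zero.comp (tendsto_pow_atTop two_ne_zero)).comp
          (tendsto_atTop_add_const_right _ (-(2 * |R|)) tendsto_id)).const_mul M
      rw [mul_zero] at this
      exact this.comp tendsto_comap
    refine squeeze_zero_norm' ?_ hlim
    filter_upwards [tendsto_comap.eventually (eventually_gt_atTop (2 * |R|))] with x hx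
    have hd : 0 < horizNorm x - 2 * |R| := by linarith
    refine (hmain x y _ hd (by linarith)).trans ?_
    refine mul_le_mul_of_nonneg_left ?_ hM0
    refine (Set.indicator_le_self' (fun _ _ => by positivity) y).trans ?_
    gcongr
    nlinarith [sq_nonneg (y 2)]

/-! ### The Newtonian field as a fundamental solution -/

/-- The denominator `|y|² + ε²` of the regularized field. -/
def softSq (ε : ℝ) (y : E3) : ℝ := ‖y‖ ^ 2 + ε ^ 2

/-- The components of the regularized Newtonian field `y / (|y|² + ε²)^{3/2}`. -/
def softNewton (ε : ℝ) (i : Fin 3) (y : E3) : ℝ := y i * softSq ε y ^ (-(3 / 2) : ℝ)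

/-- The derivative `∂ⱼ` of the `i`-th component of the regularized field; symmetric in `i`, `j`. -/
def softHess (ε : ℝ) (i j : Fin 3) (y : E3) : ℝ :=
  (if i = j then 1 else 0) * softSq ε y ^ (-(3 / 2) : ℝ) -
    3 * (y i * y j) * softSq ε y ^ (-(5 / 2) : ℝ)

section

variable {ε : ℝ}

lemma softSq_pos (hε : 0 < ε) (y : E3) : 0 < softSq ε y := by unfold softSq; positivity

lemma hasFDerivAt_softNewton (hε : 0 < ε) (i : Fin 3) (y : E3) :
    HasFDerivAt (softNewton ε i) (softSq ε y ^ (-(3 / 2) : ℝ) • coord i -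
      (3 * y i * softSq ε y ^ (-(5 / 2) : ℝ)) • innerSL ℝ y) y := by
  have h1 : HasFDerivAt (softSq ε) (2 • innerSL ℝ y) y :=
    (hasStrictFDerivAt_norm_sq y).hasFDerivAt.add_const _
  have h2 := (hasFDerivAt_coord i y).mul
    (h1.rpow_const (p := (-(3 / 2) : ℝ)) (Or.inl (softSq_pos hε y).ne'))
  refine h2.congr_fderiv ?_
  ext v
  simp
  rw [show (-(3 / 2) - 1 : ℝ) = -(5 / 2) by norm_num]
  ring

lemma fderiv_softNewton (hε : 0 < ε) (i j : Fin 3) (y : E3) :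
    fderiv ℝ (softNewton ε i) y (EuclideanSpace.single j 1) = softHess ε i j y := by
  rw [(hasFDerivAt_softNewton hε i y).fderiv]
  simp [softHess, EuclideanSpace.inner_single_right]
  ring

lemma softHess_symm (i j : Fin 3) (y : E3) : softHess ε i j y = softHess ε j i y := by
  simp only [softHess, eq_comm, mul_comm]

/-- The divergence of the regularized field, an approximation of `4π δ₀`. -/
lemma sum_softHess (hε : 0 < ε) (y : E3) :
    ∑ i, softHess ε i i y = 3 * ε ^ 2 * softSq ε y ^ (-(5 / 2) : ℝ) := by
  have hs := softSq_pos hε y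
  have h : softSq ε y ^ (-(3 / 2) : ℝ) = softSq ε y * softSq ε y ^ (-(5 / 2) : ℝ) := by
    rw [← Real.rpow_one_add' hs.le (by norm_num)]; norm_num
  have h2 := norm_sq_eq_horizSq y
  simp only [Fin.sum_univ_three, softHess, if_true, one_mul, h]
  rw [horizSq] at h2
  generalize softSq ε y ^ (-(5 / 2) : ℝ) = p
  rw [softSq, h2]
  ring

lemma softSq_rpow_le_inv_pow_three {y : E3} (hy : y ≠ 0) :
    softSq ε y ^ (-(3 / 2) : ℝ) ≤ (‖y‖ ^ 3)⁻¹ := by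
  have hy' : 0 < ‖y‖ := norm_pos_iff.2 hy
  have : (‖y‖ ^ 3)⁻¹ = (‖y‖ ^ 2) ^ (-(3 / 2) : ℝ) := by
    rw [← Real.rpow_natCast, ← Real.rpow_natCast, ← Real.rpow_mul hy'.le, ← Real.rpow_neg hy'.le]
    norm_num
  rw [this]
  exact Real.rpow_le_rpow_of_nonpos (by positivity) (by unfold softSq; nlinarith) (by norm_num)

lemma abs_softNewton_le (hε : 0 < ε) (i : Fin 3) (y : E3) :
    |softNewton ε i y| ≤ (‖y‖ ^ 2)⁻¹ := by
  have hs := softSq_pos hε y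
  rcases eq_or_ne y 0 with hy | hy
  · simp [softNewton, hy]
  · have h := softSq_rpow_le_inv_pow_three (ε := ε) hy
    have hy' : 0 < ‖y‖ := norm_pos_iff.2 hy
    have h1 : |y i| ≤ ‖y‖ := PiLp.norm_apply_le y i
    rw [softNewton, abs_mul, abs_of_nonneg (by positivity : 0 ≤ softSq ε y ^ (-(3 / 2) : ℝ))]
    calc _ ≤ ‖y‖ * (‖y‖ ^ 3)⁻¹ := by gcongr
      _ = _ := by field_simp

lemma abs_softHess_le (hε : 0 < ε) (i j : Fin 3) (y : E3) :
    |softHess ε i j y| ≤ 4 * softSq ε y ^ (-(3 / 2) : ℝ) := by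
  have hs := softSq_pos hε y
  have h : softSq ε y ^ (-(3 / 2) : ℝ) = softSq ε y * softSq ε y ^ (-(5 / 2) : ℝ) := by
    rw [← Real.rpow_one_add' hs.le (by norm_num)]; norm_num
  have hp : 0 < softSq ε y ^ (-(5 / 2) : ℝ) := by positivity
  have hi : |y i| ≤ ‖y‖ := PiLp.norm_apply_le y i
  have hj : |y j| ≤ ‖y‖ := PiLp.norm_apply_le y j
  have hij : |y i * y j| ≤ softSq ε y := by
    rw [abs_mul]
    calc _ ≤ ‖y‖ * ‖y‖ := by gcongr
      _ ≤ _ := by unfold softSq; nlinarith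
  have hδ : |(if i = j then 1 else 0 : ℝ)| ≤ 1 := by split_ifs <;> simp
  refine (abs_sub _ _).trans ?_
  rw [abs_mul, abs_mul, abs_mul, h, abs_of_pos hp, abs_of_pos (by positivity :
    0 < softSq ε y * softSq ε y ^ (-(5 / 2) : ℝ)), abs_of_pos (by norm_num : (0 : ℝ) < 3)]
  calc _ ≤ 1 * (softSq ε y * softSq ε y ^ (-(5 / 2) : ℝ)) +
        3 * softSq ε y * softSq ε y ^ (-(5 / 2) : ℝ) := by gcongr
    _ = _ := by ring

lemma measurable_softNewton (i : Fin 3) : Measurable (softNewton ε i) := by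
  unfold softNewton softSq; fun_prop

lemma measurable_softHess (i j : Fin 3) : Measurable (softHess ε i j) := by
  unfold softHess softSq; fun_prop

lemma cylIntegrable_softNewton (hε : 0 < ε) (i : Fin 3) : CylIntegrable (softNewton ε i) where
  measurable := measurable_softNewton i
  integrableOn R := (integrableOn_inv_norm_sq_cyl R).mono'
    (measurable_softNewton i).aestronglyMeasurable
    (Eventually.of_forall fun y => abs_softNewton_le hε i y)

lemma softSq_rpow_le (hε : 0 < ε) {y : E3} (hy : y ≠ 0) :
    softSq ε y ^ (-(3 / 2) : ℝ) ≤ ε⁻¹ * (‖y‖ ^ 2)⁻¹ := by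
  have hs := softSq_pos hε y
  have hy' : 0 < ‖y‖ := norm_pos_iff.2 hy
  have h1 : softSq ε y ^ (-(1 / 2) : ℝ) ≤ ε⁻¹ := by
    rw [show ε⁻¹ = (ε ^ 2) ^ (-(1 / 2) : ℝ) by
      rw [← Real.rpow_natCast, ← Real.rpow_mul hε.le, ← Real.rpow_neg_one]; norm_num]
    exact Real.rpow_le_rpow_of_nonpos (by positivity) (by unfold softSq; nlinarith) (by norm_num)
  have h2 : softSq ε y ^ (-1 : ℝ) ≤ (‖y‖ ^ 2)⁻¹ := by
    rw [Real.rpow_neg_one]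
    gcongr
    unfold softSq; nlinarith
  calc softSq ε y ^ (-(3 / 2) : ℝ) = softSq ε y ^ (-(1 / 2) : ℝ) * softSq ε y ^ (-1 : ℝ) := by
        rw [← Real.rpow_add hs]; norm_num
    _ ≤ _ := by gcongr

lemma cylIntegrable_softHess (hε : 0 < ε) (i j : Fin 3) : CylIntegrable (softHess ε i j) where
  measurable := measurable_softHess i j
  integrableOn R := by
    refine (((integrableOn_inv_norm_sq_cyl R).const_mul ε⁻¹).const_mul 4).mono'
      (measurable_softHess i j).aestronglyMeasurable (ae_restrict_of_ae ?_)
    filter_upwards [Measure.ae_ne volume (0 : E3)] with y hy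
    refine (abs_softHess_le hε i j y).trans ?_
    gcongr
    exact softSq_rpow_le hε hy

end

section

variable {κ : ℝ} {ψ : E3 → ℝ}

lemma CylIntegrable.integrable_mul {w : E3 → ℝ} (hw : CylIntegrable w) (hκ : 0 < κ)
    (h : IsTestField κ ψ) : Integrable fun y => w y * ψ y := by
  obtain ⟨R, hR⟩ := h.support
  obtain ⟨M, hM⟩ := h.bounded hκ
  refine ((hw.integrable_indicator R).const_mul M).mono'
    (hw.measurable.aestronglyMeasurable.mul h.smooth.continuous.aestronglyMeasurable)
    (Eventually.of_forall fun y => ?_)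
  have hM0 : 0 ≤ M := (norm_nonneg _).trans (hM 0)
  by_cases hy : y ∈ cyl R
  · rw [Set.indicator_of_mem hy, norm_mul, mul_comm]
    exact mul_le_mul_of_nonneg_right (hM _) (norm_nonneg _)
  · simp [Set.indicator_of_notMem hy, hR y hy]

lemma integral_softNewton_mul_partialD (hκ : 0 < κ) (h : IsTestField κ ψ) {ε : ℝ} (hε : 0 < ε)
    (i j : Fin 3) :
    ∫ y, softNewton ε i y * partialD j ψ y = -∫ y, softHess ε i j y * ψ y := by
  simp_rw [← fderiv_softNewton hε i j, partialD]
  refine integral_mul_fderiv_eq_neg_fderiv_mul_of_integrable ?_ ?_ ?_ ?_ ?_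
  · simp_rw [fderiv_softNewton hε i j]
    exact (cylIntegrable_softHess hε i j).integrable_mul hκ h
  · exact (cylIntegrable_softNewton hε i).integrable_mul hκ (h.partialD j)
  · exact (cylIntegrable_softNewton hε i).integrable_mul hκ h
  · exact fun y _ => (hasFDerivAt_softNewton hε i y).differentiableAt
  · exact fun y _ => h.smooth.differentiable (by simp) y

lemma tendsto_softNewton {y : E3} (hy : y ≠ 0) (i : Fin 3) :
    Tendsto (fun ε => softNewton ε i y) (𝓝[>] 0) (𝓝 (newton y i)) := by
  have hy' : 0 < ‖y‖ := norm_pos_iff.2 hy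
  have h : Tendsto (fun ε : ℝ => y i * (‖y‖ ^ 2 + ε ^ 2) ^ (-(3 / 2) : ℝ)) (𝓝 0)
      (𝓝 (y i * (‖y‖ ^ 2 + 0 ^ 2) ^ (-(3 / 2) : ℝ))) := by
    refine Tendsto.const_mul _ (Tendsto.rpow_const ?_ (Or.inl (by positivity)))
    exact (continuous_const.add (continuous_pow 2)).tendsto 0
  have e : y i * (‖y‖ ^ 2 + 0 ^ 2) ^ (-(3 / 2) : ℝ) = newton y i := by
    rw [newton, PiLp.smul_apply, smul_eq_mul, mul_comm, ← Real.rpow_natCast ‖y‖ 3,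
      ← Real.rpow_neg hy'.le, zero_pow two_ne_zero, add_zero, ← Real.rpow_natCast,
      ← Real.rpow_mul hy'.le]
    norm_num
  rw [e] at h
  exact h.mono_left nhdsWithin_le_nhds

lemma tendsto_integral_softNewton (hκ : 0 < κ) (h : IsTestField κ ψ) (i : Fin 3) :
    Tendsto (fun ε => ∫ y, softNewton ε i y * ψ y) (𝓝[>] 0) (𝓝 (∫ y, newton y i * ψ y)) := by
  have hw : CylIntegrable fun y : E3 => (‖y‖ ^ 2)⁻¹ :=
    ⟨by fun_prop, integrableOn_inv_norm_sq_cyl⟩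
  refine tendsto_integral_filter_of_dominated_convergence (fun y => ‖(‖y‖ ^ 2)⁻¹ * ψ y‖) ?_ ?_
    (hw.integrable_mul hκ h).norm ?_
  · exact Eventually.of_forall fun ε => (measurable_softNewton i).aestronglyMeasurable.mul
      h.smooth.continuous.aestronglyMeasurable
  · filter_upwards [self_mem_nhdsWithin] with ε (hε : 0 < ε)
    refine Eventually.of_forall fun y => ?_
    rw [norm_mul, norm_mul]
    gcongr
    exact (abs_softNewton_le hε i y).trans (le_abs_self _)
  · filter_upwards [Measure.ae_ne volume (0 : E3)] with y hy
    exact (tendsto_softNewton hy i).mul_const _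

/-- The Newtonian field is weakly curl-free. -/
lemma integral_newton_mul_partialD_symm (hκ : 0 < κ) (h : IsTestField κ ψ) (i j : Fin 3) :
    ∫ y, newton y i * partialD j ψ y = ∫ y, newton y j * partialD i ψ y := by
  refine tendsto_nhds_unique (tendsto_integral_softNewton hκ (h.partialD j) i) ?_
  refine (tendsto_integral_softNewton hκ (h.partialD i) j).congr' ?_
  filter_upwards [self_mem_nhdsWithin] with ε (hε : 0 < ε)
  rw [integral_softNewton_mul_partialD hκ h hε, integral_softNewton_mul_partialD hκ h hε]
  simp_rw [softHess_symm j i]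

lemma integral_radial_Ioi :
    ∫ r in Set.Ioi (0 : ℝ), r ^ 2 * (3 * (1 + r ^ 2) ^ (-(5 / 2) : ℝ)) = 1 := by
  have hder (r : ℝ) : HasDerivAt (fun r : ℝ => r ^ 3 * (1 + r ^ 2) ^ (-(3 / 2) : ℝ))
      (r ^ 2 * (3 * (1 + r ^ 2) ^ (-(5 / 2) : ℝ))) r := by
    have hs : 0 < 1 + r ^ 2 := by positivity
    have h1 : HasDerivAt (fun r : ℝ => 1 + r ^ 2) (2 * r) r := by
      simpa using (hasDerivAt_pow 2 r).const_add 1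
    have h := (hasDerivAt_pow 3 r).mul (h1.rpow_const (p := (-(3 / 2) : ℝ)) (Or.inl hs.ne'))
    refine h.congr_deriv ?_
    have h3 : (1 + r ^ 2) ^ (-(3 / 2) : ℝ) = (1 + r ^ 2) * (1 + r ^ 2) ^ (-(5 / 2) : ℝ) := by
      rw [← Real.rpow_one_add' hs.le (by norm_num)]; norm_num
    rw [h3, show (-(3 / 2) - 1 : ℝ) = -(5 / 2) by norm_num]
    norm_num
    ring
  have hlim : Tendsto (fun r : ℝ => r ^ 3 * (1 + r ^ 2) ^ (-(3 / 2) : ℝ)) atTop (𝓝 1) := by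
    have h1 : Tendsto (fun r : ℝ => (1 + (r ^ 2)⁻¹) ^ (-(3 / 2) : ℝ)) atTop
        (𝓝 ((1 + 0) ^ (-(3 / 2) : ℝ))) :=
      ((tendsto_inv_atTop_zero.comp (tendsto_pow_atTop two_ne_zero)).const_add 1).rpow_const
        (Or.inl (by norm_num))
    rw [add_zero, Real.one_rpow] at h1
    refine h1.congr' ?_
    filter_upwards [eventually_gt_atTop 0] with r hr
    have h2 : r ^ 3 = (r ^ 2) ^ (3 / 2 : ℝ) := by
      rw [← Real.rpow_natCast r 2, ← Real.rpow_mul hr.le, ← Real.rpow_natCast]; norm_num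
    have h3 : (1 + (r ^ 2)⁻¹) = (1 + r ^ 2) / r ^ 2 := by field_simp; ring
    rw [h2, h3, Real.div_rpow (by positivity) (by positivity),
      Real.rpow_neg (by positivity) (3 / 2),
      Real.rpow_neg (by positivity : (0 : ℝ) ≤ r ^ 2)]
    field_simp
  have h := integral_Ioi_of_hasDerivAt_of_nonneg (a := 0) (hder 0).continuousAt.continuousWithinAt
    (fun r _ => hder r) (fun r _ => by positivity) hlim
  simpa using h

/-- The total flux of the regularized field. -/
lemma integral_flux : ∫ y : E3, 3 * (1 + ‖y‖ ^ 2) ^ (-(5 / 2) : ℝ) = 4 * Real.pi := by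
  rw [integral_fun_norm_addHaar volume (fun r : ℝ => 3 * (1 + r ^ 2) ^ (-(5 / 2) : ℝ))]
  have h3 : Module.finrank ℝ E3 = 3 := by simp
  have hv : (volume : Measure E3).real (Metric.ball 0 1) = Real.pi * 4 / 3 := by
    rw [Measure.real, EuclideanSpace.volume_ball_fin_three]
    simp
    positivity
  rw [h3, hv]
  simp only [smul_eq_mul]
  rw [show 3 - 1 = 2 from rfl, integral_radial_Ioi]
  norm_num
  ring

/-- The Newtonian field is the fundamental solution of the divergence. -/
lemma sum_integral_newton_mul_partialD (hκ : 0 < κ) (h : IsTestField κ ψ) :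
    ∑ i, ∫ y, newton y i * partialD i ψ y = -(4 * Real.pi * ψ 0) := by
  have hl := tendsto_finsetSum Finset.univ fun i _ =>
    tendsto_integral_softNewton hκ (h.partialD i) i
  refine tendsto_nhds_unique hl ?_
  obtain ⟨M, hM⟩ := h.bounded hκ
  have hint : Integrable fun y : E3 => (1 + ‖y‖ ^ 2) ^ (-(5 / 2) : ℝ) := by
    have := integrable_rpow_neg_one_add_norm_sq (E := E3) (μ := volume) (r := 5)
      (by simp; norm_num)
    simpa [neg_div] using this
  -- after rescaling by `ε` the approximate identity has a fixed profile
  have hD : Tendsto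
      (fun ε : ℝ => -∫ y : E3, 3 * (1 + ‖y‖ ^ 2) ^ (-(5 / 2) : ℝ) * ψ (ε • y)) (𝓝[>] 0)
      (𝓝 (-∫ y : E3, 3 * (1 + ‖y‖ ^ 2) ^ (-(5 / 2) : ℝ) * ψ 0)) := by
    refine Tendsto.neg ?_
    refine tendsto_integral_filter_of_dominated_convergence
      (fun y => 3 * (1 + ‖y‖ ^ 2) ^ (-(5 / 2) : ℝ) * M) ?_ ?_ ((hint.const_mul 3).mul_const M) ?_
    · refine Eventually.of_forall fun ε => Measurable.aestronglyMeasurable ?_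
      have := h.smooth.continuous.measurable
      fun_prop
    · refine Eventually.of_forall fun ε => Eventually.of_forall fun y => ?_
      rw [norm_mul, Real.norm_of_nonneg (by positivity)]
      gcongr
      exact hM _
    · refine Eventually.of_forall fun y => Tendsto.const_mul _ ?_
      have hc : Continuous fun ε : ℝ => ψ (ε • y) := h.smooth.continuous.comp (by fun_prop)
      have := (hc.tendsto 0).mono_left (nhdsWithin_le_nhds (s := Set.Ioi 0))
      simpa using this
  rw [integral_mul_const, integral_flux] at hD
  refine hD.congr' ?_
  filter_upwards [self_mem_nhdsWithin] with ε (hε : 0 < ε)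
  simp_rw [integral_softNewton_mul_partialD hκ h hε]
  rw [Finset.sum_neg_distrib, ← integral_finsetSum _ fun i _ =>
    (cylIntegrable_softHess hε i i).integrable_mul hκ h]
  simp_rw [← Finset.sum_mul, sum_softHess hε]
  congr 1
  have hsc := Measure.integral_comp_smul (volume : Measure E3)
    (fun y => 3 * ε ^ 2 * softSq ε y ^ (-(5 / 2) : ℝ) * ψ y) ε
  have h3 : Module.finrank ℝ E3 = 3 := by simp
  rw [h3, abs_of_pos (by positivity), smul_eq_mul, eq_inv_mul_iff_mul_eq₀ (by positivity)] at hsc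
  rw [← hsc, ← integral_const_mul]
  refine integral_congr_ae (Eventually.of_forall fun y => ?_)
  have e : softSq ε (ε • y) = ε ^ 2 * (1 + ‖y‖ ^ 2) := by
    rw [softSq, norm_smul, mul_pow, Real.norm_eq_abs, sq_abs]; ring
  have e2 : (ε ^ 2 : ℝ) ^ (-(5 / 2) : ℝ) = (ε ^ 5)⁻¹ := by
    rw [← Real.rpow_natCast, ← Real.rpow_mul hε.le, ← Real.rpow_natCast, ← Real.rpow_neg hε.le]
    norm_num
  simp only [e]
  rw [Real.mul_rpow (by positivity) (by positivity), e2]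
  field_simp

end

lemma IsTestField.comp_sub {κ : ℝ} {φ : E3 → ℝ} (h : IsTestField κ φ) (x : E3) :
    IsTestField κ fun y => φ (x - y) where
  smooth := h.smooth.comp (by fun_prop)
  periodic y := by
    have := h.periodic (x - (y + period κ))
    rw [sub_add_eq_sub_sub, sub_add_cancel] at this
    simpa only [sub_add_eq_sub_sub] using this.symm
  support := by
    obtain ⟨R, hR⟩ := h.support
    exact ⟨R + ‖x‖, fun y hy => hR _ fun hc => hy (mem_cyl_of_sub_mem le_rfl hc)⟩

lemma partialD_comp_sub {κ : ℝ} {φ : E3 → ℝ} (h : IsTestField κ φ) (x y : E3) (i : Fin 3) :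
    partialD i (fun y => φ (x - y)) y = -partialD i φ (x - y) := by
  have hd := ((h.smooth.differentiable (by simp) (x - y)).hasFDerivAt).comp y
    ((hasFDerivAt_id y).const_sub x)
  rw [partialD, show (fun y => φ (x - y)) = φ ∘ HSub.hSub x from rfl, hd.fderiv]
  simp [partialD]

lemma cylConv_newton_symm {κ : ℝ} {φ : E3 → ℝ} (hκ : 0 < κ) (h : IsTestField κ φ) (i j : Fin 3)
    (x : E3) : cylConv (fun y => newton y i) (partialD j φ) x =
      cylConv (fun y => newton y j) (partialD i φ) x := by
  have := integral_newton_mul_partialD_symm hκ (h.comp_sub x) i j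
  simp_rw [partialD_comp_sub h, mul_neg, integral_neg] at this
  exact neg_injective this

lemma sum_cylConv_newton {κ : ℝ} {φ : E3 → ℝ} (hκ : 0 < κ) (h : IsTestField κ φ) (x : E3) :
    ∑ i, cylConv (fun y => newton y i) (partialD i φ) x = 4 * Real.pi * φ x := by
  have := sum_integral_newton_mul_partialD hκ (h.comp_sub x)
  simp_rw [partialD_comp_sub h, mul_neg, integral_neg, Finset.sum_neg_distrib] at this
  simpa [cylConv] using neg_injective this

/-! ### Uniqueness by the maximum principle -/

section

variable {f g : E3 → ℝ}

lemma contDiff_partialD (hf : ContDiff ℝ ∞ f) (i : Fin 3) : ContDiff ℝ ∞ (partialD i f) :=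
  (hf.fderiv_right (m := ∞) (by simp)).clm_apply contDiff_const

lemma partialD_comm (hf : ContDiff ℝ ∞ f) (i j : Fin 3) (x : E3) :
    partialD i (partialD j f) x = partialD j (partialD i f) x := by
  have hd : DifferentiableAt ℝ (fderiv ℝ f) x :=
    (hf.fderiv_right (m := ∞) (by simp)).differentiable (by simp) x
  have key (i j : Fin 3) : partialD i (partialD j f) x =
      fderiv ℝ (fderiv ℝ f) x (EuclideanSpace.single i 1) (EuclideanSpace.single j 1) := by
    have := (hd.hasFDerivAt.clm_apply
      (hasFDerivAt_const (EuclideanSpace.single j (1 : ℝ)) x)).fderiv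
    rw [partialD, show partialD j f = fun y => fderiv ℝ f y (EuclideanSpace.single j 1) from rfl,
      this]
    simp
  rw [key, key]
  exact (hf.contDiffAt.isSymmSndFDerivAt (by simp; exact WithTop.coe_le_coe.2 le_top)) _ _

lemma partialD_sub (hf : ContDiff ℝ ∞ f) (hg : ContDiff ℝ ∞ g) (i : Fin 3) (x : E3) :
    partialD i (fun y => f y - g y) x = partialD i f x - partialD i g x := by
  rw [partialD, fderiv_fun_sub (hf.differentiable (by simp) x) (hg.differentiable (by simp) x)]
  rfl

lemma partialD_add (hf : ContDiff ℝ ∞ f) (hg : ContDiff ℝ ∞ g) (i : Fin 3) (x : E3) :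
    partialD i (fun y => f y + g y) x = partialD i f x + partialD i g x := by
  rw [partialD, fderiv_fun_add (hf.differentiable (by simp) x) (hg.differentiable (by simp) x)]
  rfl

lemma partialD_const_mul (hf : ContDiff ℝ ∞ f) (c : ℝ) (i : Fin 3) (x : E3) :
    partialD i (fun y => c * f y) x = c * partialD i f x := by
  rw [partialD, fderiv_const_mul (hf.differentiable (by simp) x)]
  rfl

/-- At a local maximum the pure second derivatives are nonpositive. -/
lemma partialD_partialD_nonpos_of_isLocalMax (hf : ContDiff ℝ ∞ f) {x : E3} (hx : IsLocalMax f x)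
    (i : Fin 3) : partialD i (partialD i f) x ≤ 0 := by
  by_contra! hpos
  set e : E3 := EuclideanSpace.single i 1 with he
  have hline (t : ℝ) : HasDerivAt (fun t : ℝ => x + t • e) e t := by
    simpa using ((hasDerivAt_id t).smul_const e).const_add x
  have hcomp {g : E3 → ℝ} (hg : ContDiff ℝ ∞ g) :
      deriv (fun t : ℝ => g (x + t • e)) = fun t => partialD i g (x + t • e) := by
    funext t
    exact ((hg.differentiable (by simp) _).hasFDerivAt.comp_hasDerivAt t (hline t)).deriv
  have hc : Continuous fun t : ℝ => x + t • e := by fun_prop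
  have hmax : IsLocalMax (fun t : ℝ => f (x + t • e)) 0 := by
    have h0 : Tendsto (fun t : ℝ => x + t • e) (𝓝 0) (𝓝 x) := by
      simpa using hc.tendsto 0
    simpa [IsLocalMax, IsMaxFilter] using h0.eventually hx
  have h2 : deriv (deriv fun t : ℝ => f (x + t • e)) 0 = partialD i (partialD i f) x := by
    rw [hcomp hf, hcomp (contDiff_partialD hf i)]; simp
  have hmin := isLocalMin_of_deriv_deriv_pos (by rw [h2]; exact hpos) hmax.deriv_eq_zero
    (hf.continuous.comp hc).continuousAt
  have hconst : (fun t : ℝ => f (x + t • e)) =ᶠ[𝓝 0] fun _ => f (x + (0 : ℝ) • e) := by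
    filter_upwards [hmax, hmin] with t h1 h2 using le_antisymm h1 h2
  have h3 := hconst.deriv.deriv_eq
  rw [h2] at h3
  simp at h3
  linarith

end

lemma continuous_horizNorm : Continuous horizNorm := continuous_horizSq.sqrt

lemma abs_apply_zero_le_horizNorm (x : E3) : |x 0| ≤ horizNorm x :=
  Real.abs_le_sqrt (by nlinarith [sq_nonneg (x 1)])

lemma abs_apply_one_le_horizNorm (x : E3) : |x 1| ≤ horizNorm x :=
  Real.abs_le_sqrt (by nlinarith [sq_nonneg (x 0)])

/-- The maximum principle: a periodic harmonic function that vanishes far from the axis is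
nonpositive. -/
lemma nonpos_of_harmonic {κ : ℝ} (hκ : 0 < κ) {h : E3 → ℝ} (hs : ContDiff ℝ ∞ h)
    (hp : Function.Periodic h (period κ)) (hΔ : ∀ x, ∑ i, partialD i (partialD i h) x = 0)
    (hlim : Tendsto h (comap horizNorm atTop) (𝓝 0)) (x : E3) : h x ≤ 0 := by
  refine le_of_forall_pos_le_add fun δ hδ => ?_
  rw [zero_add]
  have hev := hlim.eventually (gt_mem_nhds hδ)
  rw [eventually_comap, eventually_atTop] at hev
  obtain ⟨R₀, hR₀⟩ := hev
  set R := max R₀ (horizNorm x) with hR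
  have hR0 : 0 ≤ R := (Real.sqrt_nonneg _).trans (le_max_right _ _)
  refine le_of_forall_pos_le_add fun η hη => ?_
  -- the perturbation `ε x₁²` makes the function strictly subharmonic
  set ε := η / (R ^ 2 + 1) with hε
  have hε0 : 0 < ε := by positivity
  have hεR : ε * R ^ 2 ≤ η := by
    rw [hε, div_mul_eq_mul_div, div_le_iff₀ (by positivity)]
    nlinarith
  have hq : ContDiff ℝ ∞ fun y : E3 => y 0 ^ 2 := by fun_prop
  have hl : ContDiff ℝ ∞ fun y : E3 => y 0 := by fun_prop
  let g : E3 → ℝ := fun y => h y + ε * y 0 ^ 2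
  have hg : ContDiff ℝ ∞ g := hs.add (contDiff_const.mul hq)
  have hd1 (i : Fin 3) (y : E3) : partialD i (fun y : E3 => y 0) y = if i = 0 then 1 else 0 := by
    rw [partialD, (hasFDerivAt_coord 0 y).fderiv]
    simp [eq_comm]
  have hd2 (i : Fin 3) (y : E3) : partialD i (fun y : E3 => y 0 ^ 2) y =
      (if i = 0 then 2 else 0) * y 0 := by
    rw [partialD, ((hasFDerivAt_coord 0 y).pow 2).fderiv]
    fin_cases i <;> simp
  have hΔg (y : E3) : ∑ i, partialD i (partialD i g) y = 2 * ε := by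
    have h1 (i : Fin 3) : partialD i g =
        fun y => partialD i h y + ε * ((if i = 0 then 2 else 0) * y 0) := by
      funext y
      rw [partialD_add hs (contDiff_const.mul hq), partialD_const_mul hq, hd2]
    have h2 (i : Fin 3) : partialD i (partialD i g) y = partialD i (partialD i h) y +
        ε * ((if i = 0 then 2 else 0) * (if i = 0 then 1 else 0)) := by
      rw [h1, partialD_add (contDiff_partialD hs i) (contDiff_const.mul (contDiff_const.mul hl)),
        partialD_const_mul (contDiff_const.mul hl), partialD_const_mul hl, hd1]
    simp_rw [h2, Finset.sum_add_distrib, hΔ]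
    simp [mul_comm]
  have hgp : Function.Periodic g (period κ) := fun y => by
    simp only [g, hp y, PiLp.add_apply, period_zero, add_zero]
  let K : Set E3 := {y | horizNorm y ≤ R} ∩ {y | y 2 ∈ Set.Icc 0 (2 * Real.pi * κ)}
  have hK : IsCompact K := by
    refine (isCompact_cyl_inter R (2 * Real.pi * κ)).of_isClosed_subset
      ((isClosed_le continuous_horizNorm continuous_const).inter
        (isClosed_Icc.preimage (by fun_prop : Continuous fun y : E3 => y 2))) fun y hy => ?_
    exact ⟨⟨(abs_apply_zero_le_horizNorm y).trans hy.1,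
      (abs_apply_one_le_horizNorm y).trans hy.1⟩, hy.2⟩
  have hmem (y : E3) (hy : horizNorm y ≤ R) : ∃ z ∈ K, g z = g y := by
    obtain ⟨k, hk⟩ := exists_add_zsmul_period hκ y
    obtain ⟨h0, h1⟩ := horizontal_add_zsmul_period κ y k
    refine ⟨y + k • period κ, ⟨?_, hk⟩, hgp.zsmul k y⟩
    simpa only [Set.mem_ofPred_eq, horizNorm, h0, h1] using hy
  have hxR : horizNorm x ≤ R := le_max_right _ _
  obtain ⟨z₀, hz₀, -⟩ := hmem x hxR
  obtain ⟨z, hz, hmax⟩ := hK.exists_isMaxOn ⟨z₀, hz₀⟩ hg.continuous.continuousOn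
  have hle (y : E3) (hy : horizNorm y ≤ R) : g y ≤ g z := by
    obtain ⟨w, hw, hwy⟩ := hmem y hy
    rw [← hwy]; exact hmax hw
  rcases lt_or_ge (horizNorm z) R with hlt | hge
  · have hloc : IsLocalMax g z := by
      filter_upwards [continuous_horizNorm.continuousAt.eventually (gt_mem_nhds hlt)] with y hy
      exact hle y hy.le
    have : ∑ i, partialD i (partialD i g) z ≤ 0 := Finset.sum_nonpos fun i _ =>
      partialD_partialD_nonpos_of_isLocalMax hg hloc i
    rw [hΔg] at this
    linarith
  · have h1 : h z < δ := hR₀ _ ((le_max_left _ _).trans hge) z rfl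
    have h2 : z 0 ^ 2 ≤ R ^ 2 := by
      have := (abs_apply_zero_le_horizNorm z).trans hz.1
      exact sq_le_sq' (abs_le.1 this).1 (abs_le.1 this).2
    have h3 := hle x hxR
    simp only [g] at h3
    nlinarith [sq_nonneg (x 0)]

/-- A divergence-free and curl-free field has harmonic components. -/
lemma harmonic_of_curl_eq_zero {w : E3 → E3} (hw : ContDiff ℝ ∞ w) (hc : ∀ x, curl w x = 0)
    (hd : ∀ x, divg w x = 0) (i : Fin 3) (x : E3) :
    ∑ j, partialD j (partialD j fun y => w y i) x = 0 := by
  have hs (i : Fin 3) : ContDiff ℝ ∞ fun y => w y i := by fun_prop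
  have h0 (x : E3) : partialD 1 (fun y => w y 2) x = partialD 2 (fun y => w y 1) x := by
    have : curl w x 0 = 0 := by rw [hc]; rfl
    exact sub_eq_zero.1 this
  have h1 (x : E3) : partialD 2 (fun y => w y 0) x = partialD 0 (fun y => w y 2) x := by
    have : curl w x 1 = 0 := by rw [hc]; rfl
    exact sub_eq_zero.1 this
  have h2 (x : E3) : partialD 0 (fun y => w y 1) x = partialD 1 (fun y => w y 0) x := by
    have : curl w x 2 = 0 := by rw [hc]; rfl
    exact sub_eq_zero.1 this
  have hsymm (i j : Fin 3) : partialD j (fun y => w y i) = partialD i fun y => w y j := by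
    funext y
    fin_cases i <;> fin_cases j <;>
      first | rfl | exact h0 y | exact h1 y | exact h2 y | exact (h0 y).symm | exact (h1 y).symm |
        exact (h2 y).symm
  have hdiv : (fun y => partialD 0 (fun y => w y 0) y + partialD 1 (fun y => w y 1) y +
      partialD 2 (fun y => w y 2) y) = fun _ => 0 := by
    funext y
    rw [← hd y, divg, Fin.sum_univ_three]
  have hc' (j : Fin 3) := contDiff_partialD (hs j) j
  calc ∑ j, partialD j (partialD j fun y => w y i) x
      = ∑ j, partialD i (partialD j fun y => w y j) x := by
        refine Finset.sum_congr rfl fun j _ => ?_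
        rw [hsymm i j, partialD_comm (hs j)]
    _ = partialD i (fun _ => 0) x := by
        rw [← hdiv, partialD_add ((hc' 0).add (hc' 1)) (hc' 2), partialD_add (hc' 0) (hc' 1),
          Fin.sum_univ_three]
    _ = 0 := by simp [partialD]

lemma tendsto_apply {α : Type*} {l : Filter α} {u : α → E3} (h : Tendsto u l (𝓝 0)) (i : Fin 3) :
    Tendsto (fun x => u x i) l (𝓝 0) := by
  simpa [Function.comp_def] using ((coord i).continuous.tendsto 0).comp h

/-- By the maximum principle any solution is dominated by any other, in each component. -/
lemma IsSmoothSolution.apply_le {κ : ℝ} (hκ : 0 < κ) {Φ u v : E3 → E3}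
    (hu : IsSmoothSolution κ Φ u) (hv : IsSmoothSolution κ Φ v) (i : Fin 3) (x : E3) :
    u x i ≤ v x i := by
  have hus (i : Fin 3) : ContDiff ℝ ∞ fun y => u y i := by have := hu.smooth; fun_prop
  have hvs (i : Fin 3) : ContDiff ℝ ∞ fun y => v y i := by have := hv.smooth; fun_prop
  have hpd (i j : Fin 3) (x : E3) : partialD i (fun y => (u y - v y) j) x =
      partialD i (fun y => u y j) x - partialD i (fun y => v y j) x :=
    partialD_sub (hus j) (hvs j) i x
  have hc (x : E3) : curl (fun y => u y - v y) x = 0 := by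
    have : curl (fun y => u y - v y) x = curl u x - curl v x := by
      simp only [curl, hpd]
      ext i
      fin_cases i <;> simp <;> ring
    rw [this, hu.curl_eq, hv.curl_eq, sub_self]
  have hd (x : E3) : divg (fun y => u y - v y) x = 0 := by
    have : divg (fun y => u y - v y) x = divg u x - divg v x := by
      simp only [divg, hpd, Finset.sum_sub_distrib]
    rw [this, hu.div_eq, hv.div_eq, sub_self]
  have := nonpos_of_harmonic hκ (h := fun y => (u y - v y) i) ((hus i).sub (hvs i))
    (fun y => by
      have h1 := hu.periodic y
      have h2 := hv.periodic y
      simp only [period, h1, h2])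
    (harmonic_of_curl_eq_zero (hu.smooth.sub hv.smooth) hc hd i)
    (tendsto_apply (by simpa using hu.decay.sub hv.decay) i) x
  simpa using this

lemma IsSmoothSolution.unique {κ : ℝ} (hκ : 0 < κ) {Φ u v : E3 → E3}
    (hu : IsSmoothSolution κ Φ u) (hv : IsSmoothSolution κ Φ v) : u = v := by
  funext x
  ext i
  exact le_antisymm (hu.apply_le hκ hv i x) (hv.apply_le hκ hu i x)

/-! ### The Biot–Savart integral -/

/-- The Biot–Savart field of `Φ`, as an integral over one period. -/
def biotSavart (κ : ℝ) (Φ : E3 → E3) (x : E3) : E3 :=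
  ∫ y in Omega κ, cross (kernel κ (x - y)) (Φ y)

section

variable {κ : ℝ} {Φ : E3 → E3}

lemma IsSmoothCompactPeriodic.isTestField (hΦ : IsSmoothCompactPeriodic κ Φ) :
    IsTestField κ Φ where
  smooth := hΦ.smooth
  periodic := hΦ.periodic
  support := by
    obtain ⟨R, hR⟩ := hΦ.compact_support
    refine ⟨R, fun x hx => hR x ?_⟩
    by_contra! h
    exact hx ⟨(abs_apply_zero_le_horizNorm x).trans h, (abs_apply_one_le_horizNorm x).trans h⟩

lemma IsTestField.apply (h : IsTestField κ Φ) (i : Fin 3) : IsTestField κ fun x => Φ x i :=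
  h.clm_comp (coord i)

lemma measurable_cross {f g : E3 → E3} (hf : Measurable f) (hg : Measurable g) :
    Measurable fun y => cross (f y) (g y) :=
  continuous_cross.measurable.comp (hf.prodMk hg)

lemma integrable_cross_newton (hκ : 0 < κ) (h : IsTestField κ Φ) (x : E3) :
    Integrable fun y => cross (newton y) (Φ (x - y)) := by
  have hw : CylIntegrable fun y : E3 => (‖y‖ ^ 2)⁻¹ :=
    ⟨by fun_prop, integrableOn_inv_norm_sq_cyl⟩
  refine (hw.integrable hκ h x).mono (measurable_cross measurable_newton
    (h.smooth.continuous.measurable.comp (by fun_prop))).aestronglyMeasurable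
    (Eventually.of_forall fun y => ?_)
  refine (norm_cross_le _ _).trans ?_
  rw [norm_newton, norm_smul, Real.norm_of_nonneg (by positivity)]

lemma integrable_cross_newton_sub (hκ : 0 < κ) (h : IsTestField κ Φ) (x : E3) :
    Integrable fun y => -(1 / (4 * Real.pi)) • cross (newton (x - y)) (Φ y) := by
  have := (integrable_cross_newton hκ h x).comp_sub_left x
  simp only [sub_sub_cancel] at this
  exact this.smul (-(1 / (4 * Real.pi)))

/-- The Biot–Savart integrand over one period is the periodization of the whole-space one. -/
lemma cross_kernel_ae_eq (hκ : 0 < κ) (h : IsTestField κ Φ) (x : E3) :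
    ∀ᵐ y, cross (kernel κ (x - y)) (Φ y) = ∑' k : ℤ, -(1 / (4 * Real.pi)) •
      cross (newton (x - (y + (k : ℝ) • period κ))) (Φ (y + (k : ℝ) • period κ)) := by
  have h0 : ∀ᵐ y : E3, y 0 ≠ x 0 := by
    rw [ae_iff]; simpa using volume_hyperplane 0 (x 0)
  filter_upwards [h0] with y hy
  have hpos : 0 < horizSq (x - y) := by
    have : 0 < (x 0 - y 0) ^ 2 := by
      have := sub_ne_zero.2 hy.symm
      positivity
    simp only [horizSq, PiLp.sub_apply]
    positivity
  have hper (k : ℤ) : Φ (y + (k : ℝ) • period κ) = Φ y := by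
    rw [Int.cast_smul_eq_zsmul]; exact h.periodic.zsmul k y
  simp_rw [hper, ← crossRight_apply, ← map_smul]
  have hs : Summable fun k : ℤ => newton (x - y + (k : ℝ) • period κ) :=
    (summable_norm_newton_image hκ (x - y)).of_norm
  rw [kernel_eq_tsum hκ hpos, ← hs.tsum_const_smul, ContinuousLinearMap.map_tsum _
    (hs.const_smul _), ← (Equiv.neg ℤ).tsum_eq]
  refine tsum_congr fun k => ?_
  congr 3
  simp only [Equiv.neg_apply, Int.cast_neg, neg_smul]
  abel

lemma integrableOn_cross_kernel (hκ : 0 < κ) (h : IsTestField κ Φ) (x : E3) :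
    IntegrableOn (fun y => cross (kernel κ (x - y)) (Φ y)) (Omega κ) := by
  refine integrableOn_tsum_translate hκ (integrable_cross_newton_sub hκ h x)
    (Measurable.aestronglyMeasurable ?_) (cross_kernel_ae_eq hκ h x)
  have hg : Measurable fun y => ∇ (green κ) y :=
    ((InnerProductSpace.toDual ℝ E3).symm.continuous.measurable).comp
      (measurable_fderiv ℝ (green κ))
  have hk : Measurable (kernel κ) := hg.const_smul (1 / (4 * Real.pi ^ 2))
  exact measurable_cross (hk.comp (by fun_prop)) h.smooth.continuous.measurable

/-- Unfolding turns the integral over one period into a whole-space convolution. -/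
lemma biotSavart_eq (hκ : 0 < κ) (h : IsTestField κ Φ) (x : E3) :
    biotSavart κ Φ x = -(1 / (4 * Real.pi)) • ∫ y, cross (newton y) (Φ (x - y)) := by
  rw [biotSavart, integral_congr_ae (ae_restrict_of_ae (cross_kernel_ae_eq hκ h x)),
    integral_tsum_translate hκ (integrable_cross_newton_sub hκ h x), integral_smul,
    ← integral_sub_left_eq_self _ volume x]
  simp

/-- The convolution `(newton)_b ∗ Φ_c`, from which the Biot–Savart field is assembled. -/
def newtonConv (Φ : E3 → E3) (b c : Fin 3) : E3 → ℝ :=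
  cylConv (fun y => newton y b) fun x => Φ x c

lemma biotSavart_apply (hκ : 0 < κ) (h : IsTestField κ Φ) {i b c : Fin 3}
    (hi : ∀ v w : E3, cross v w i = v b * w c - v c * w b) :
    (fun x => biotSavart κ Φ x i) =
      fun x => -(1 / (4 * Real.pi)) * (newtonConv Φ b c x - newtonConv Φ c b x) := by
  funext x
  rw [biotSavart_eq hκ h, PiLp.smul_apply, smul_eq_mul, newtonConv, newtonConv, cylConv, cylConv,
    ← integral_sub ((cylIntegrable_newton b).integrable hκ (h.apply c) x)
      ((cylIntegrable_newton c).integrable hκ (h.apply b) x)]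
  congr 1
  have := (coord i).integral_comp_comm (integrable_cross_newton hκ h x)
  rw [PiLp.proj_apply] at this
  rw [← this]
  refine integral_congr_ae (Eventually.of_forall fun y => ?_)
  simp [hi]

lemma contDiff_newtonConv (hκ : 0 < κ) (h : IsTestField κ Φ) (b c : Fin 3) :
    ContDiff ℝ ∞ (newtonConv Φ b c) :=
  contDiff_infty_cylConv hκ (cylIntegrable_newton b) (h.apply c)

lemma isSmoothSolution_biotSavart (hκ : 0 < κ) (h : IsTestField κ Φ)
    (hdiv : ∀ x, divg Φ x = 0) : IsSmoothSolution κ Φ (biotSavart κ Φ) := by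
  have hπ := Real.pi_pos
  have h0 := biotSavart_apply hκ h (i := 0) cross_zero_apply
  have h1 := biotSavart_apply hκ h (i := 1) cross_one_apply
  have h2 := biotSavart_apply hκ h (i := 2) cross_two_apply
  have hs := contDiff_newtonConv hκ h
  -- `D j b c` is the derivative of `(newton)_b ∗ Φ_c` in the direction `j`
  let D (j b c : Fin 3) : E3 → ℝ :=
    cylConv (fun y => newton y b) (partialD j fun x => Φ x c)
  have hD (j b c : Fin 3) (x : E3) : partialD j (newtonConv Φ b c) x = D j b c x :=
    partialD_cylConv hκ (cylIntegrable_newton b) (h.apply c) j x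
  have hD' (j b c : Fin 3) (x : E3) : partialD j
      (fun x => -(1 / (4 * Real.pi)) * (newtonConv Φ b c x - newtonConv Φ c b x)) x =
      -(1 / (4 * Real.pi)) * (D j b c x - D j c b x) := by
    rw [partialD_const_mul ((hs b c).sub (hs c b)), partialD_sub (hs b c) (hs c b), hD, hD]
  have hsymm (j b c : Fin 3) (x : E3) : D j b c x = D b j c x :=
    cylConv_newton_symm hκ (h.apply c) b j x
  have hsum (c : Fin 3) (x : E3) : D 0 0 c x + D 1 1 c x + D 2 2 c x = 4 * Real.pi * Φ x c := by
    rw [← sum_cylConv_newton hκ (h.apply c) x, Fin.sum_univ_three]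
  have hdivD (b : Fin 3) (x : E3) : D 0 b 0 x + D 1 b 1 x + D 2 b 2 x = 0 := by
    have hi (j : Fin 3) :=
      (cylIntegrable_newton b).integrable hκ ((h.apply j).partialD j) x
    simp only [D, cylConv]
    rw [← integral_add (hi 0) (hi 1), ← integral_add (by exact (hi 0).add (hi 1)) (hi 2)]
    refine integral_eq_zero_of_ae (Eventually.of_forall fun y => ?_)
    have := hdiv (x - y)
    rw [divg, Fin.sum_univ_three] at this
    simp only [smul_eq_mul, Pi.zero_apply, ← mul_add, this, mul_zero]
  have hc : 1 / (4 * Real.pi) * (4 * Real.pi) = 1 := by field_simp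
  refine ⟨?_, fun x => ?_, fun x => ?_, ?_, fun x => ?_⟩
  · refine contDiff_euclidean.2 fun i => ?_
    have hcd (b c : Fin 3) : ContDiff ℝ ∞
        fun x => -(1 / (4 * Real.pi)) * (newtonConv Φ b c x - newtonConv Φ c b x) :=
      contDiff_const.mul ((hs b c).sub (hs c b))
    fin_cases i
    · exact h0 ▸ hcd 1 2
    · exact h1 ▸ hcd 2 0
    · exact h2 ▸ hcd 0 1
  · -- `curl (N × Φ) = N div Φ - (N · ∇) Φ` under the integral sign
    simp only [curl, h0, h1, h2, hD']
    ext i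
    fin_cases i
    · simp
      linear_combination -(1 / (4 * Real.pi)) * hdivD 0 x + 1 / (4 * Real.pi) * hsum 0 x +
        Φ x 0 * hc
    · simp
      linear_combination -(1 / (4 * Real.pi)) * hdivD 1 x + 1 / (4 * Real.pi) * hsum 1 x +
        Φ x 1 * hc
    · simp
      linear_combination -(1 / (4 * Real.pi)) * hdivD 2 x + 1 / (4 * Real.pi) * hsum 2 x +
        Φ x 2 * hc
  · rw [divg, Fin.sum_univ_three, h0, h1, h2, hD', hD', hD', hsymm 0 1 2, hsymm 0 2 1, hsymm 1 2 0]
    ring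
  · have hlim (b c : Fin 3) : Tendsto
        (fun x => -(1 / (4 * Real.pi)) * (newtonConv Φ b c x - newtonConv Φ c b x))
        (comap horizNorm atTop) (𝓝 0) := by
      have := ((tendsto_cylConv_newton hκ (h.apply c) b).sub
        (tendsto_cylConv_newton hκ (h.apply b) c)).const_mul (-(1 / (4 * Real.pi)))
      simpa [newtonConv] using this
    have hpi : Tendsto (fun x => WithLp.ofLp (biotSavart κ Φ x)) (comap horizNorm atTop)
        (𝓝 0) := by
      refine tendsto_pi_nhds.2 fun i => ?_
      fin_cases i
      · exact h0 ▸ hlim 1 2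
      · exact h1 ▸ hlim 2 0
      · exact h2 ▸ hlim 0 1
    exact ((PiLp.continuous_toLp 2 (fun _ : Fin 3 => ℝ)).tendsto 0).comp hpi
  · rw [biotSavart_eq hκ h, biotSavart_eq hκ h]
    congr 2
    funext y
    congr 1
    rw [add_sub_right_comm]
    exact h.periodic (x - y)

end

end PeriodicBiotSavart

end

theorem proposition3p5 (κ : ℝ) (hκ : 0 < κ)
    (Φ : PeriodicBiotSavart.E3 → PeriodicBiotSavart.E3)
    (hΦ : PeriodicBiotSavart.IsSmoothCompactPeriodic κ Φ)
    (hdiv : ∀ x, PeriodicBiotSavart.divg Φ x = 0)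
    (hint : ∫ x in PeriodicBiotSavart.Omega κ, Φ x = 0) :
    (∃! u : PeriodicBiotSavart.E3 → PeriodicBiotSavart.E3,
        PeriodicBiotSavart.IsSmoothSolution κ Φ u) ∧
    (∀ x, IntegrableOn
        (fun y => PeriodicBiotSavart.cross (PeriodicBiotSavart.kernel κ (x - y)) (Φ y))
        (PeriodicBiotSavart.Omega κ)) ∧
    PeriodicBiotSavart.IsSmoothSolution κ Φ (fun x =>
      ∫ y in PeriodicBiotSavart.Omega κ,
        PeriodicBiotSavart.cross (PeriodicBiotSavart.kernel κ (x - y)) (Φ y)) := by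
  have h := PeriodicBiotSavart.isSmoothSolution_biotSavart hκ hΦ.isTestField hdiv
  exact ⟨⟨_, h, fun v hv => hv.unique hκ h⟩,
    PeriodicBiotSavart.integrableOn_cross_kernel hκ hΦ.isTestField, h⟩
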